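/- Let $k$ be an algebraically closed field and $A$ a (not necessarily finite-dimensional) $k$-algebra; let $A\text{-mod}$ be the category of finite-dimensional $A$-modules. For $N,M\in A\text{-mod}$ let $Z(N,M)$ be the space of $k$-linear maps $\delta:A\to\operatorname{Hom}_k(N,M)$ with $\delta(ab)=a\delta(b)+\delta(a)b$, and $B(N,M)\subseteq Z(N,M)$ the subspace of all maps $a\mapsto M(a)\circ r-r\circ N(a)$, $r\in\operatorname{Hom}_k(N,M)$, where $M(a)$ denotes the action of $a$ on $M$; so $Z(N,M)/B(N,M)\cong\operatorname{Ext}^1_A(N,M)$. For $U\in A\text{-mod}$ let $\operatorname{add}(U)$ be the full subcategory of all direct summands of finite powers $U^m$. A morphism $f:M\to N$ of an additive category is called radical if $1-gf$ is invertible for all $g:N\to M$; the radical morphisms form the radical $\mathcal R$ of the category ($\mathcal R_A$ for $A\text{-mod}$). Let $X_1,\dots,X_r$ be pairwise non-isomorphic indecomposable finite-dimensional $A$-modules, let $Y_1,\dots,Y_s$ also be pairwise non-isomorphic indecomposable finite-dimensional $A$-modules, put $X=\bigoplus_i X_i$, $Y=\bigoplus_j Y_j$, and assume $\operatorname{Hom}_A(X,Y)=0$.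 For $N\in\operatorname{add}(Y)$, $M\in\operatorname{add}(X)$ let $(\operatorname{Rad}Z)(N,M)\subseteq Z(N,M)$ be the subspace generated by all $f\zeta$ with $T\in\operatorname{add}(X)$, $\zeta\in Z(N,T)$, $f:T\to M$ radical, and all $\zeta g$ with $S\in\operatorname{add}(Y)$, $\zeta\in Z(S,M)$, $g:N\to S$ radical. For all $i,j$ assume that $\overline Z(Y_j,X_i):=Z(Y_j,X_i)/\big((\operatorname{Rad}Z)(Y_j,X_i)+B(Y_j,X_i)\big)$ (that is, $\operatorname{Ext}^1_A(Y_j,X_i)$ modulo its radical) is finite-dimensional, and choose $\zeta^{(ij)}_1,\dots,\zeta^{(ij)}_{n_{ij}}\in Z(Y_j,X_i)$ whose residue classes form a basis of it. Let $K$ be the bipartite quiver with vertices $Y_1,\dots,Y_s,X_1,\dots,X_r$ and arrows $\alpha^{(ij)}_1,\dots,\alpha^{(ij)}_{n_{ij}}:Y_j\to X_i$, and let $K\text{-rep}$ be the category of its finite-dimensional representations over $k$. Define $F:K\text{-rep}\to A\text{-mod}$ as follows: as a vector space $FM=\bigoplus_i X_i\otimes_k M(X_i)\ \oplus\ \bigoplus_j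 Y_j\otimes_k M(Y_j)$, and $a\in A$ acts by the matrix $\begin{bmatrix}\bigoplus_i X_i(a)\otimes\mathrm{id}&\zeta^{(FM)}(a)\\0&\bigoplus_j Y_j(a)\otimes\mathrm{id}\end{bmatrix}$, where $\zeta^{(FM)}(a)$ has the $(i,j)$ entry $\sum_{l}\zeta^{(ij)}_l(a)\otimes M(\alpha^{(ij)}_l)$; for $\varphi:M\to M'$ put $F\varphi=\bigoplus_i \mathrm{id}\otimes\varphi_{X_i}\oplus\bigoplus_j\mathrm{id}\otimes\varphi_{Y_j}$. Let $\mathcal F(Y,X)$ be the full subcategory of $A\text{-mod}$ of all $N$ for which there is an exact sequence $0\to V\to N\to W\to0$ with $V\in\operatorname{add}(X)$ and $W\in\operatorname{add}(Y)$. Then: 1. $F$ is a $k$-linear, exact and faithful functor. 2. $F$ induces a full functor $K\text{-rep}\to A\text{-mod}/\mathcal R_A$: for every $A$-linear $f:FM\to FM'$ there is $\varphi:M\to M'$ with $f-F\varphi\in\mathcal R_A(FM,FM')$. 3. If $M$ is an indecomposable representation of $K$, then $FM$ is an indecomposable $A$-module. 4. If $M,M'$ are representations of $K$ with $FM\cong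 FM'$, then $M\cong M'$. 5. $FM\in\mathcal F(Y,X)$ for every representation $M$ of $K$. 6. Assume in addition that $\dim\operatorname{Hom}_A(X_i,X_{i'})=\delta_{ii'}$ and $\dim\operatorname{Hom}_A(Y_j,Y_{j'})=\delta_{jj'}$ for all $i,i',j,j'$. Then for every $N\in\mathcal F(Y,X)$ there is a representation $M$ of $K$ with $FM\cong N$. If moreover $\operatorname{Hom}_A(Y,X)=0$, then $F$ is full, $F$ induces an equivalence $K\text{-rep}\to\mathcal F(Y,X)$, and $\mathcal F(Y,X)$ is closed under kernels and cokernels in $A\text{-mod}$. -/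

import Mathlib

open CategoryTheory CategoryTheory.Limits
open scoped TensorProduct

universe u v

noncomputable section

namespace ExtFunctor

/-! ### Finite-dimensional modules over an arbitrary `k`-algebra -/

section FdMod

variable (k : Type u) [Field k] (A : Type v) [Ring A] [Algebra k A]

/-- The `A`-modules that are finite-dimensional over `k`. -/
def isFd : ObjectProperty (ModuleCat.{u} A) :=
  fun M => @Module.Finite k M _ _ M.moduleOfAlgebraModule

/-- The category `A`-mod of `A`-modules that are finite-dimensional over `k`. -/
abbrev FdMod : Type (max (u + 1) v) := (isFd k A).FullSubcategory

instance (M : FdMod k A) : Module k M.obj := M.obj.moduleOfAlgebraModule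

instance (M : FdMod k A) : IsScalarTower k A M.obj := M.obj.isScalarTower_of_algebra_moduleCat

instance (M : FdMod k A) : Module.Finite k M.obj := M.property

/-- Finiteness may be tested with any `k`-structure that is compatible with the `A`-structure. -/
theorem isFd_of (M : ModuleCat.{u} A) [m : Module k M] [hf : Module.Finite k M]
    (h : ∀ (c : k) (x : M), algebraMap k A c • x = c • x) : isFd k A M := by
  have : m = M.moduleOfAlgebraModule := by
    refine Module.ext' _ _ fun c x => ?_
    exact (h c x).symm
  subst this
  exact hf

instance : (isFd k A).IsClosedUnderSubobjects where
  prop_of_mono {M N} f _ hN := by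
    let _ := M.moduleOfAlgebraModule (k := k)
    let _ := N.moduleOfAlgebraModule (k := k)
    have := M.isScalarTower_of_algebra_moduleCat (k := k)
    have := N.isScalarTower_of_algebra_moduleCat (k := k)
    have : Module.Finite k N := hN
    exact Module.Finite.of_injective (f.hom.restrictScalars k)
      ((ModuleCat.mono_iff_injective f).1 ‹_›)

instance : (isFd k A).IsClosedUnderQuotients where
  prop_of_epi {M N} f _ hM := by
    let _ := M.moduleOfAlgebraModule (k := k)
    let _ := N.moduleOfAlgebraModule (k := k)
    have := M.isScalarTower_of_algebra_moduleCat (k := k)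
    have := N.isScalarTower_of_algebra_moduleCat (k := k)
    have : Module.Finite k M := hM
    exact Module.Finite.of_surjective (f.hom.restrictScalars k)
      ((ModuleCat.epi_iff_surjective f).1 ‹_›)

instance : (isFd k A).ContainsZero where
  exists_zero := by
    refine ⟨ModuleCat.of A PUnit, ModuleCat.isZero_of_subsingleton _, ?_⟩
    let _ := (ModuleCat.of A PUnit.{u + 1}).moduleOfAlgebraModule (k := k)
    change Module.Finite k (ModuleCat.of A PUnit.{u + 1})
    have : Finite (ModuleCat.of A PUnit.{u + 1}) := inferInstanceAs (Finite PUnit)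
    exact Module.Finite.of_finite

instance : (isFd k A).IsClosedUnderFiniteProducts where
  isClosedUnderLimitsOfShape J _ := by
    refine ⟨?_⟩
    rintro Z ⟨h⟩
    let _ : ∀ j : J, Module k (h.diag.obj ⟨j⟩) := fun j => (h.diag.obj ⟨j⟩).moduleOfAlgebraModule
    have : ∀ j : J, Module.Finite k (h.diag.obj ⟨j⟩) := fun j => h.prop_diag_obj ⟨j⟩
    have : ∀ j : J, IsScalarTower k A (h.diag.obj ⟨j⟩) :=
      fun j => (h.diag.obj ⟨j⟩).isScalarTower_of_algebra_moduleCat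
    let P : ModuleCat.{u} A := ModuleCat.of A (∀ j : J, h.diag.obj ⟨j⟩)
    let _ : Module k P := inferInstanceAs (Module k (∀ j : J, h.diag.obj ⟨j⟩))
    have : Module.Finite k P := inferInstanceAs (Module.Finite k (∀ j : J, h.diag.obj ⟨j⟩))
    have hP : isFd k A P := isFd_of k A P fun c x => by
      funext j
      exact algebraMap_smul A c ((x : ∀ j : J, h.diag.obj ⟨j⟩) j)
    let q : ∀ j, P ⟶ h.diag.obj ⟨j⟩ := fun j =>
      ModuleCat.ofHom (LinearMap.proj (R := A) (φ := fun j : J => h.diag.obj ⟨j⟩) j)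
    let f : Z ⟶ P := ModuleCat.ofHom (LinearMap.pi fun j => (h.π.app ⟨j⟩).hom)
    have hf : ∀ j, f ≫ q j = h.π.app ⟨j⟩ := fun j => rfl
    have : Mono f := ⟨fun a b hab => h.isLimit.hom_ext fun ⟨j⟩ => by
      change a ≫ h.π.app ⟨j⟩ = b ≫ h.π.app ⟨j⟩
      rw [← hf j, ← Category.assoc, hab, Category.assoc]⟩
    exact (isFd k A).prop_of_mono f hP

instance : HasFiniteBiproducts (FdMod k A) := HasFiniteBiproducts.of_hasFiniteProducts


end FdMod

/-! ### The radical of a category and the subcategory `add U` -/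

/-- The radical of a preadditive category: `f : M ⟶ N` is radical if `1 - g f` is invertible for
every `g : N ⟶ M`. The radical of a full subcategory is the restriction of this. -/
def IsRadical {C : Type*} [Category C] [Preadditive C] {M N : C} (f : M ⟶ N) : Prop :=
  ∀ g : N ⟶ M, IsIso (𝟙 M - f ≫ g)

/-- `add U`: the direct summands of the finite powers of `U`. -/
def addCat {C : Type*} [Category C] [Preadditive C] [HasFiniteBiproducts C] (U : C) :
    ObjectProperty C :=
  fun T => ∃ m : ℕ, Nonempty (Retract T (⨁ fun _ : Fin m => U))

/-! ### Cocycles -/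

section Cocycles

variable (k : Type u) [Field k] (A : Type v) [Ring A] [Algebra k A]
variable (N : Type u) [AddCommGroup N] [Module k N] [Module A N] [IsScalarTower k A N]
variable (M : Type u) [AddCommGroup M] [Module k M] [Module A M] [IsScalarTower k A M]

/-- `Z¹(N, M)`: the `k`-linear derivations of `A` with values in the bimodule `Hom_k(N, M)`. -/
def Z : Submodule k (A →ₗ[k] N →ₗ[k] M) where
  carrier := {δ | ∀ (a b : A) (y : N), δ (a * b) y = a • δ b y + δ a (b • y)}
  add_mem' {δ ε} hδ hε a b y := by
    simp only [LinearMap.add_apply, hδ a b y, hε a b y, smul_add]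
    abel
  zero_mem' a b y := by simp
  smul_mem' c δ hδ a b y := by
    simp only [LinearMap.smul_apply, hδ a b y, smul_add, smul_comm c a]

/-- The map `d : Hom_k(N, M) → Z¹(N, M)`, `d(r)(a) = M(a) ∘ r - r ∘ N(a)`. -/
def d : (N →ₗ[k] M) →ₗ[k] Z k A N M where
  toFun r := ⟨{
      toFun := fun a => Algebra.lsmul k k M a ∘ₗ r - r ∘ₗ Algebra.lsmul k k N a
      map_add' := fun a b => by ext y; simp; abel
      map_smul' := fun c a => by ext y; simp [smul_sub] },
    fun a b y => by simp [smul_sub]⟩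
  map_add' r t := by ext a y; simp; abel
  map_smul' c r := by ext a y; simp [smul_sub, smul_comm c a]

/-- `B¹(N, M)`: the inner derivations. -/
def B : Submodule k (Z k A N M) := LinearMap.range (d k A N M)

variable {k A N M}

/-- The composition `f ζ ∈ Z¹(N, M')` of `ζ ∈ Z¹(N, M)` with `f : M → M'`. -/
def push {M' : Type u} [AddCommGroup M'] [Module k M'] [Module A M'] [IsScalarTower k A M']
    (f : M →ₗ[A] M') (ζ : Z k A N M) : Z k A N M' :=
  ⟨{  toFun := fun a => f.restrictScalars k ∘ₗ ζ.1 a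
      map_add' := fun a b => by ext y; simp
      map_smul' := fun c a => by ext y; simp },
    fun a b y => by simp [ζ.2 a b y]⟩

/-- The composition `ζ g ∈ Z¹(N', M)` of `ζ ∈ Z¹(N, M)` with `g : N' → N`. -/
def pull {N' : Type u} [AddCommGroup N'] [Module k N'] [Module A N'] [IsScalarTower k A N']
    (ζ : Z k A N M) (g : N' →ₗ[A] N) : Z k A N' M :=
  ⟨{  toFun := fun a => ζ.1 a ∘ₗ g.restrictScalars k
      map_add' := fun a b => by ext y; simp
      map_smul' := fun c a => by ext y; simp },
    fun a b y => by simp [ζ.2 a b (g y)]⟩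

set_option linter.unusedSectionVars false in
theorem map_algebraMap (ζ : Z k A N M) (c : k) : ζ.1 (algebraMap k A c) = 0 := by
  have h1 : ζ.1 1 = 0 := by
    ext y
    have := ζ.2 1 1 y
    simpa using this
  rw [Algebra.algebraMap_eq_smul_one, map_smul, h1, smul_zero]

/-- The `A`-module structure on `M × N` in which `a` acts by the matrix
`[M(a), ζ(a); 0, N(a)]`. -/
@[reducible]
def extModule (ζ : Z k A N M) : Module A (M × N) where
  smul a p := (a • p.1 + ζ.1 a p.2, a • p.2)
  one_smul p := by
    have := map_algebraMap ζ 1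
    rw [map_one] at this
    refine Prod.ext ?_ ?_
    · change (1 : A) • p.1 + ζ.1 1 p.2 = p.1
      simp [this]
    · exact one_smul A p.2
  mul_smul a b p := by
    refine Prod.ext ?_ ?_
    · change (a * b) • p.1 + ζ.1 (a * b) p.2 = a • (b • p.1 + ζ.1 b p.2) + ζ.1 a (b • p.2)
      rw [ζ.2, mul_smul, smul_add, add_assoc]
    · exact mul_smul a b p.2
  smul_zero a := by
    refine Prod.ext ?_ ?_
    · change a • (0 : M) + ζ.1 a 0 = 0
      simp
    · exact smul_zero a
  smul_add a p q := by
    refine Prod.ext ?_ ?_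
    · change a • (p.1 + q.1) + ζ.1 a (p.2 + q.2) = (a • p.1 + ζ.1 a p.2) + (a • q.1 + ζ.1 a q.2)
      rw [smul_add, map_add]
      abel
    · exact smul_add a p.2 q.2
  add_smul a b p := by
    refine Prod.ext ?_ ?_
    · change (a + b) • p.1 + ζ.1 (a + b) p.2 = (a • p.1 + ζ.1 a p.2) + (b • p.1 + ζ.1 b p.2)
      rw [add_smul, map_add, LinearMap.add_apply]
      abel
    · exact add_smul a b p.2
  zero_smul p := by
    refine Prod.ext ?_ ?_
    · change (0 : A) • p.1 + ζ.1 0 p.2 = 0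
      simp
    · exact zero_smul A p.2

/-- The extension of `N` by `M` given by the cocycle `ζ`, as an object of `A`-mod. -/
def ext [Module.Finite k M] [Module.Finite k N] (ζ : Z k A N M) : FdMod k A :=
  ⟨@ModuleCat.of A _ (M × N) _ (extModule ζ), by
    let E : ModuleCat.{u} A := @ModuleCat.of A _ (M × N) _ (extModule ζ)
    let _ : Module k E := inferInstanceAs (Module k (M × N))
    have : Module.Finite k E := inferInstanceAs (Module.Finite k (M × N))
    refine isFd_of k A E fun c p => ?_
    refine Prod.ext ?_ ?_
    · change algebraMap k A c • (p : M × N).1 + ζ.1 (algebraMap k A c) (p : M × N).2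
        = c • (p : M × N).1
      rw [map_algebraMap ζ, LinearMap.zero_apply, add_zero, algebraMap_smul]
    · exact algebraMap_smul A c (p : M × N).2⟩

/-- The morphism of extensions given by the matrix `[f, 0; 0, g]`, for `f ζ = ζ' g`. -/
def extMap {M' N' : Type u} [AddCommGroup M'] [Module k M'] [Module A M'] [IsScalarTower k A M']
    [AddCommGroup N'] [Module k N'] [Module A N'] [IsScalarTower k A N']
    [Module.Finite k M] [Module.Finite k N] [Module.Finite k M'] [Module.Finite k N']
    (ζ : Z k A N M) (ζ' : Z k A N' M') (f : M →ₗ[A] M') (g : N →ₗ[A] N')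
    (h : push f ζ = pull ζ' g) : ext ζ ⟶ ext ζ' :=
  ObjectProperty.homMk (@ModuleCat.ofHom A _ (M × N) (M' × N') _ (extModule ζ) _ (extModule ζ')
    (@LinearMap.mk A A _ _ (RingHom.id A) (M × N) (M' × N') _ _ (extModule ζ) (extModule ζ')
      ⟨fun p => (f p.1, g p.2), fun p q => by simp⟩
      (fun a p => by
        refine Prod.ext ?_ ?_
        · change f (a • p.1 + ζ.1 a p.2) = a • f p.1 + ζ'.1 a (g p.2)
          have h' : f (ζ.1 a p.2) = ζ'.1 a (g p.2) :=
            congrArg (fun δ : Z k A N M' => δ.1 a p.2) h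
          rw [map_add, map_smul, h']
        · exact map_smul g a p.2)))

end Cocycles

/-! ### The radical of `Z¹` as a bifunctor on `add Y × add X` -/

section Radical

variable {k : Type u} [Field k] {A : Type v} [Ring A] [Algebra k A]

/-- `(Rad Z)(N, M)` for the bifunctor `Z¹` on `add Y × add X`: the subspace generated by all
`f ζ` with `f : T ⟶ M` radical, `T` in `add X`, and all `ζ g` with `g : N ⟶ S` radical, `S` in
`add Y`. -/
def radZ (Y X N M : FdMod k A) : Submodule k (Z k A N.obj M.obj) :=
  Submodule.span k
    ({η | ∃ (T : FdMod k A) (f : T ⟶ M) (ζ : Z k A N.obj T.obj),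
        addCat X T ∧ IsRadical f ∧ η = push f.hom.hom ζ} ∪
      {η | ∃ (S : FdMod k A) (g : N ⟶ S) (ζ : Z k A S.obj M.obj),
        addCat Y S ∧ IsRadical g ∧ η = pull ζ g.hom.hom})

/-- The residue classes of the family `b` form a basis of
`Z̄(N, M) = Z(N, M) / ((Rad Z)(N, M) + B(N, M))`: modulo `Rad Z + B`, every cocycle is a unique
linear combination of the `b l`. -/
def IsBasisModRad (Y X N M : FdMod k A) {m : ℕ} (b : Fin m → Z k A N.obj M.obj) : Prop :=
  ∀ z : Z k A N.obj M.obj, ∃! c : Fin m → k,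
    z - ∑ l, c l • b l ∈ radZ Y X N M ⊔ B k A N.obj M.obj

end Radical

/-! ### The bipartite quiver and its representations -/

/-- The bipartite quiver with sources `Y_j`, sinks `X_i` and `n i j` arrows `Y_j → X_i`. -/
inductive BipQuiver {r s : ℕ} (n : Fin r → Fin s → ℕ) : Type
  | y : Fin s → BipQuiver n
  | x : Fin r → BipQuiver n

/-- The arrows of the bipartite quiver. -/
def BipQuiver.Arrow {r s : ℕ} {n : Fin r → Fin s → ℕ} : BipQuiver n → BipQuiver n → Type
  | .y j, .x i => Fin (n i j)
  | _, _ => Empty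

instance {r s : ℕ} (n : Fin r → Fin s → ℕ) : Quiver (BipQuiver n) where
  Hom := BipQuiver.Arrow

section Rep

variable (k : Type u) [Field k] {r s : ℕ} (n : Fin r → Fin s → ℕ)

/-- The category of finite-dimensional representations of the bipartite quiver. -/
abbrev KRep := Paths (BipQuiver n) ⥤ FGModuleCat.{u} k

variable {k n}

/-- The space `M(Y_j)`. -/
abbrev atY (M : KRep k n) (j : Fin s) : FGModuleCat.{u} k :=
  M.obj ((Paths.of (BipQuiver n)).obj (.y j))

/-- The space `M(X_i)`. -/
abbrev atX (M : KRep k n) (i : Fin r) : FGModuleCat.{u} k :=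
  M.obj ((Paths.of (BipQuiver n)).obj (.x i))

/-- The arrow `Y_j → X_i` with index `l`. -/
def arrow {i : Fin r} {j : Fin s} (l : Fin (n i j)) : (.y j : BipQuiver n) ⟶ .x i := l

/-- The linear map `M(α) : M(Y_j) → M(X_i)` of the arrow `α` with index `l`. -/
def act (M : KRep k n) {i : Fin r} {j : Fin s} (l : Fin (n i j)) : atY M j →ₗ[k] atX M i :=
  (M.map ((Paths.of (BipQuiver n)).map (arrow l))).hom.hom

end Rep

/-! ### The functor -/

section Functor

variable {k : Type u} [Field k] {A : Type v} [Ring A] [Algebra k A]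

/-- `F_U V = ⨁ U_i ⊗ V_i`, with `A` acting on the left factors. -/
abbrev SumTensor {m : ℕ} (U : Fin m → FdMod k A) (V : Fin m → FGModuleCat.{u} k) : Type u :=
  ∀ i, (U i).obj ⊗[k] V i

/-- `F_U f = ⨁ id ⊗ f_i`. -/
def sumTensorMap {m : ℕ} (U : Fin m → FdMod k A) {V V' : Fin m → FGModuleCat.{u} k}
    (f : ∀ i, V i →ₗ[k] V' i) : SumTensor U V →ₗ[A] SumTensor U V' :=
  LinearMap.pi fun i =>
    TensorProduct.AlgebraTensorModule.map (LinearMap.id : (U i).obj →ₗ[A] (U i).obj) (f i) ∘ₗ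
      LinearMap.proj i

theorem sumTensorMap_id_apply {m : ℕ} (U : Fin m → FdMod k A) (V : Fin m → FGModuleCat.{u} k)
    (p : SumTensor U V) : sumTensorMap U (fun i => (LinearMap.id : V i →ₗ[k] V i)) p = p := by
  funext i
  change TensorProduct.AlgebraTensorModule.map LinearMap.id LinearMap.id (p i) = p i
  rw [TensorProduct.AlgebraTensorModule.map_id, LinearMap.id_apply]

theorem sumTensorMap_comp_apply {m : ℕ} (U : Fin m → FdMod k A)
    {V V' V'' : Fin m → FGModuleCat.{u} k} (f : ∀ i, V i →ₗ[k] V' i) (g : ∀ i, V' i →ₗ[k] V'' i)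
    (p : SumTensor U V) :
    sumTensorMap U (fun i => g i ∘ₗ f i) p = sumTensorMap U g (sumTensorMap U f p) := by
  funext i
  change TensorProduct.AlgebraTensorModule.map LinearMap.id (g i ∘ₗ f i) (p i) =
    TensorProduct.AlgebraTensorModule.map LinearMap.id (g i)
      (TensorProduct.AlgebraTensorModule.map LinearMap.id (f i) (p i))
  rw [← LinearMap.comp_apply, ← TensorProduct.AlgebraTensorModule.map_comp, LinearMap.comp_id]

variable {r s : ℕ} (X : Fin r → FdMod k A) (Y : Fin s → FdMod k A) {n : Fin r → Fin s → ℕ}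
  (ζ : ∀ i j, Fin (n i j) → Z k A (Y j).obj (X i).obj)

/-- The map `Θ`: the cocycle with `(i, j)` entry `∑ₗ ζ_l ⊗ c_l`, the sum being over the arrows
`Y_j → X_i`. -/
def theta {W : Fin s → FGModuleCat.{u} k} {V : Fin r → FGModuleCat.{u} k}
    (c : ∀ i j, Fin (n i j) → (W j →ₗ[k] V i)) : Z k A (SumTensor Y W) (SumTensor X V) :=
  ⟨{  toFun := fun a => LinearMap.pi fun i =>
        ∑ j, ∑ l, TensorProduct.map ((ζ i j l).1 a) (c i j l) ∘ₗ LinearMap.proj j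
      map_add' := fun a b => by
        ext w i
        simp [TensorProduct.map_add_left, Finset.sum_add_distrib]
      map_smul' := fun t a => by
        ext w i
        simp [TensorProduct.map_smul_left, Finset.smul_sum] },
    fun a b w => by
      ext i
      simp only [LinearMap.coe_mk, AddHom.coe_mk, LinearMap.pi_apply, LinearMap.sum_apply,
        LinearMap.comp_apply, LinearMap.proj_apply, Pi.add_apply, Pi.smul_apply, Finset.smul_sum,
        ← Finset.sum_add_distrib]
      refine Finset.sum_congr rfl fun j _ => Finset.sum_congr rfl fun l _ => ?_
      induction w j using TensorProduct.induction_on with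
      | zero => simp
      | tmul p q =>
        simp only [TensorProduct.map_tmul, TensorProduct.smul_tmul', (ζ i j l).2 a b p,
          TensorProduct.add_tmul]
      | add p q hp hq =>
        simp only [map_add, smul_add, hp, hq]
        abel⟩

theorem theta_natural {M M' : KRep k n} (f : M ⟶ M') :
    push (sumTensorMap X fun i => (f.app ((Paths.of (BipQuiver n)).obj (.x i))).hom.hom)
        (theta X Y ζ fun _ _ l => act M l) =
      pull (theta X Y ζ fun _ _ l => act M' l)
        (sumTensorMap Y fun j => (f.app ((Paths.of (BipQuiver n)).obj (.y j))).hom.hom) := by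
  refine Subtype.ext (LinearMap.ext fun a => LinearMap.ext fun w => funext fun i => ?_)
  simp only [push, pull, theta, sumTensorMap, LinearMap.coe_mk, AddHom.coe_mk, LinearMap.pi_apply,
    LinearMap.sum_apply, LinearMap.comp_apply, LinearMap.proj_apply,
    LinearMap.coe_restrictScalars, map_sum]
  refine Finset.sum_congr rfl fun j _ => Finset.sum_congr rfl fun l _ => ?_
  induction w j using TensorProduct.induction_on with
  | zero => simp
  | tmul p q =>
    have h := congrArg (fun t => t.hom.hom q)
      (f.naturality ((Paths.of (BipQuiver n)).map (arrow (i := i) (j := j) l)))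
    simp only [TensorProduct.map_tmul, TensorProduct.AlgebraTensorModule.map_tmul,
      LinearMap.id_apply]
    exact congrArg (fun t => (ζ i j l).1 a p ⊗ₜ[k] t) h
  | add p q hp hq => simp only [map_add, hp, hq]

/-- The functor `F : K`-rep `⥤ A`-mod. -/
def F : KRep k n ⥤ FdMod k A where
  obj M := ext (theta X Y ζ fun _ _ l => act M l)
  map f := extMap _ _ _ _ (theta_natural X Y ζ f)
  map_id M := by
    refine ObjectProperty.hom_ext _ (ModuleCat.hom_ext (LinearMap.ext fun p => Prod.ext ?_ ?_))
    · exact sumTensorMap_id_apply X _ p.1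
    · exact sumTensorMap_id_apply Y _ p.2
  map_comp f g := by
    refine ObjectProperty.hom_ext _ (ModuleCat.hom_ext (LinearMap.ext fun p => Prod.ext ?_ ?_))
    · exact sumTensorMap_comp_apply X _ _ p.1
    · exact sumTensorMap_comp_apply Y _ _ p.2

/-- `𝓕(Y, X)`: the modules `M` with an exact sequence `0 → V → M → W → 0`, `V` in `add X` and `W`
in `add Y`. -/
def Filt (Y X : FdMod k A) : ObjectProperty (FdMod k A) := fun M =>
  ∃ S : ShortComplex (FdMod k A), S.ShortExact ∧ addCat X S.X₁ ∧ addCat Y S.X₃ ∧ S.X₂ = M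

end Functor

end ExtFunctor

end

/-! Since Hom(X, Y) = 0, every morphism FM → FM' is an upper triangular matrix [f, t; 0, g], and
being A-linear amounts to fζ - ζ'g = d t (`exists_triHom`). Modulo the radical, f has the form ⨁ id
⊗ φ_i, because its entries between different X_i are radical and End(X_i) is k plus its radical;
likewise g becomes ⨁ id ⊗ ψ_j (`exists_sumTensorMap_isRadical`). Replacing f and g by these residues
changes fζ - ζ'g by terms with radical factors, so every entry of φζ - ζ'ψ lies in Rad Z + B. Such
an entry is a combination of the chosen cocycles, with coefficients read off from φ M(α) - M'(α) ψ.
Independence modulo Rad Z + B makes them vanish, so (φ, ψ) is a morphism of representations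
(`exists_sub_F_map`). What remains is triangular with radical diagonal, and it is radical because
every test morphism back is triangular too (`isRadical_triHom`).

Claims 3 and 4 then follow formally. A radical correction of an isomorphism is an isomorphism, and F
reflects isomorphisms. A projection of FM onto a summand lifts modulo the radical to an endomorphism
of M, which is nilpotent or invertible if M is indecomposable.

If the Hom spaces have dimension δ, radical maps between sums of the X_i, or of the Y_j, vanish.
Then Rad Z = 0, the chosen cocycles form a basis of Ext¹, and every extension with ends in add X and
add Y has a cocycle cohomologous to one of the form Θ(c) (`exists_theta_isTri`). If also Hom(Y, X) =
0, the only possible remainder t is an A-linear map from a sum of Y_j to a sum of X_i, hence zero: F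
is full, and an exact full functor has an essential image closed under kernels and cokernels. -/

namespace ExtFunctor

/-! ### Radical morphisms, `addCat` and idempotents of indecomposable objects -/

section Generic

variable {C : Type*} [Category C] [Preadditive C]

/-- If `1 - f g` is invertible then so is `1 - g f`. -/
theorem isIso_one_sub_comp_swap {M N : C} (f : M ⟶ N) (g : N ⟶ M) (h : IsIso (𝟙 M - f ≫ g)) :
    IsIso (𝟙 N - g ≫ f) := by
  obtain ⟨u, h1, h2⟩ := h
  simp only [Preadditive.sub_comp, Preadditive.comp_sub, Category.id_comp, Category.comp_id,
    Category.assoc] at h1 h2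
  -- The inverse comes from the formal geometric series: 1 + g(1 + fg + ...)f.
  refine ⟨𝟙 N + g ≫ u ≫ f, ?_, ?_⟩
  · have h3 : g ≫ (u - f ≫ g ≫ u) ≫ f = g ≫ f := by rw [h1, Category.id_comp]
    simp only [Preadditive.sub_comp, Preadditive.comp_sub, Category.assoc] at h3
    simp only [Preadditive.sub_comp, Preadditive.comp_add, Category.id_comp, Category.comp_id,
      Category.assoc]
    rw [← h3]
    abel
  · have h3 : g ≫ (u - u ≫ f ≫ g) ≫ f = g ≫ f := by rw [h2, Category.id_comp]
    simp only [Preadditive.sub_comp, Preadditive.comp_sub, Category.assoc] at h3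
    simp only [Preadditive.add_comp, Preadditive.comp_sub, Category.id_comp, Category.comp_id,
      Category.assoc]
    calc _ = 𝟙 N + ((g ≫ u ≫ f - g ≫ u ≫ f ≫ g ≫ f) - g ≫ f) := by abel
      _ = 𝟙 N := by rw [h3, sub_self, add_zero]

namespace IsRadical

variable {L M N : C}

/-- Factor out u: the other factor 1 - f g u⁻¹ is invertible by definition of radical. This lets
radical terms be subtracted from any isomorphism, not only from identities. -/
theorem isIso_iso_sub {f : M ⟶ N} (hf : IsRadical f) (g : N ⟶ L) (u : M ⟶ L) [IsIso u] :
    IsIso (u - f ≫ g) := by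
  have h : u - f ≫ g = (𝟙 M - f ≫ g ≫ inv u) ≫ u := by simp
  rw [h]
  have := hf (g ≫ inv u)
  infer_instance

theorem add {f f' : M ⟶ N} (hf : IsRadical f) (hf' : IsRadical f') : IsRadical (f + f') := by
  intro g
  have := hf g
  have := hf'.isIso_iso_sub g (𝟙 M - f ≫ g)
  rwa [Preadditive.add_comp, ← sub_sub]

theorem zero : IsRadical (0 : M ⟶ N) := fun g => by
  rw [zero_comp, sub_zero]
  infer_instance

theorem neg {f : M ⟶ N} (hf : IsRadical f) : IsRadical (-f) := fun g => by
  simpa using hf (-g)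

theorem comp_right {f : M ⟶ N} (hf : IsRadical f) (g : N ⟶ L) : IsRadical (f ≫ g) := fun h => by
  rw [Category.assoc]
  exact hf _

/-- The definition tests on one side only, so the swap between 1 - ab and 1 - ba is used twice to
move g around. -/
theorem comp_left {f : M ⟶ N} (hf : IsRadical f) (g : L ⟶ M) : IsRadical (g ≫ f) := fun h => by
  have := isIso_one_sub_comp_swap f (h ≫ g) (hf _)
  have := isIso_one_sub_comp_swap h (g ≫ f) (by simpa using this)
  exact this

theorem sum {ι : Type*} (s : Finset ι) {f : ι → (M ⟶ N)} (hf : ∀ i ∈ s, IsRadical (f i)) :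
    IsRadical (∑ i ∈ s, f i) :=
  Finset.sum_induction f IsRadical (fun _ _ => add) zero hf

theorem smul {k : Type*} [Semiring k] [Linear k C] {f : M ⟶ N} (hf : IsRadical f) (c : k) :
    IsRadical (c • f) := fun g => by
  simpa using hf (c • g)

end IsRadical

theorem isIso_of_isRadical_sub {M N : C} (f g : M ⟶ N) [IsIso f] (h : IsRadical (f - g)) :
    IsIso g := by
  have := h.isIso_iso_sub (𝟙 N) f
  simpa using this

theorem isZero_of_isRadical_id {M : C} (h : IsRadical (𝟙 M)) : IsZero M := by
  have := h (𝟙 M)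
  simp only [Category.comp_id, sub_self] at this
  rw [IsZero.iff_id_eq_zero, ← IsIso.hom_inv_id (0 : M ⟶ M), zero_comp]

/-- Membership in `add U` means that the identity factors through a power of `U`. -/
theorem addCat_iff [HasFiniteBiproducts C] (U T : C) :
    addCat U T ↔ ∃ (m : ℕ) (a : Fin m → (T ⟶ U)) (b : Fin m → (U ⟶ T)), ∑ j, a j ≫ b j = 𝟙 T := by
  constructor
  · rintro ⟨m, ⟨ρ⟩⟩
    refine ⟨m, fun j => ρ.i ≫ biproduct.π (fun _ => U) j,
      fun j => biproduct.ι (fun _ => U) j ≫ ρ.r, ?_⟩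
    have h : ∑ j, (ρ.i ≫ biproduct.π (fun _ => U) j) ≫ biproduct.ι (fun _ => U) j ≫ ρ.r =
        ρ.i ≫ (∑ j, biproduct.π (fun _ : Fin m => U) j ≫ biproduct.ι (fun _ => U) j) ≫ ρ.r := by
      simp only [Preadditive.sum_comp, Preadditive.comp_sum, Category.assoc]
    rw [h, biproduct.total, Category.id_comp, ρ.retract]
  · rintro ⟨m, a, b, h⟩
    exact ⟨m, ⟨⟨biproduct.lift a, biproduct.desc b, by rw [biproduct.lift_desc, h]⟩⟩⟩

theorem addCat_of_sum [HasFiniteBiproducts C] {U T : C} {ι : Type*} [Fintype ι] (a : ι → (T ⟶ U))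
    (b : ι → (U ⟶ T)) (h : ∑ j, a j ≫ b j = 𝟙 T) : addCat U T := by
  rw [addCat_iff]
  let e := (Fintype.equivFin ι).symm
  exact ⟨_, fun j => a (e j), fun j => b (e j), by
    rw [← h]
    exact e.sum_comp fun j => a j ≫ b j⟩

/-- An idempotent endomorphism of an indecomposable object is trivial. -/
theorem eq_zero_or_eq_id_of_indecomposable [IsIdempotentComplete C] [HasBinaryBiproducts C] {M : C}
    (hM : Indecomposable M) (e : M ⟶ M) (he : e ≫ e = e) : e = 0 ∨ e = 𝟙 M := by
  obtain ⟨P, i, p, hip, hpi⟩ := IsIdempotentComplete.idempotents_split M e he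
  have he' : (𝟙 M - e) ≫ (𝟙 M - e) = 𝟙 M - e := by simp [he]
  obtain ⟨Q, j, q, hjq, hqj⟩ := IsIdempotentComplete.idempotents_split M (𝟙 M - e) he'
  -- The images of e and 1 - e are orthogonal because e(1 - e) = 0; the split maps p and j are then
  -- cancelled by their one-sided inverses.
  have h1 : i ≫ q = 0 := by
    have h : (i ≫ p) ≫ i ≫ (q ≫ j) ≫ q = i ≫ (p ≫ i ≫ q ≫ j) ≫ q := by simp
    have h' : p ≫ i ≫ q ≫ j = 0 := by
      rw [← Category.assoc, hpi, hqj]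
      simp [he]
    rw [h', hip, Category.assoc, hjq] at h
    simpa using h
  have h2 : j ≫ p = 0 := by
    have h : (j ≫ q) ≫ j ≫ (p ≫ i) ≫ p = j ≫ (q ≫ j ≫ p ≫ i) ≫ p := by simp
    have h' : q ≫ j ≫ p ≫ i = 0 := by
      rw [← Category.assoc, hpi, hqj]
      simp [he]
    rw [h', hjq, Category.assoc, hip] at h
    simpa using h
  let φ : M ≅ P ⊞ Q :=
    { hom := biprod.lift p q
      inv := biprod.desc i j
      hom_inv_id := by rw [biprod.lift_desc, hpi, hqj]; simp
      inv_hom_id := by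
        ext <;> simp [hip, hjq, h1, h2] }
  rcases hM.2 P Q φ with h | h
  · left
    rw [← hpi, h.eq_of_tgt p 0, zero_comp]
  · right
    rw [h.eq_of_tgt q 0, zero_comp] at hqj
    exact (sub_eq_zero.1 hqj.symm).symm

end Generic

/-- In an algebra without nontrivial idempotents every integral element is nilpotent or
invertible. -/
theorem isUnit_or_isNilpotent {k E : Type*} [Field k] [Ring E] [Algebra k E]
    (hE : ∀ e : E, e * e = e → e = 0 ∨ e = 1) (x : E) (hx : IsIntegral k x) :
    IsUnit x ∨ IsNilpotent x := by
  -- Write the minimal polynomial as Xⁿ q with q prime to X, as in Fitting's lemma.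
  obtain ⟨q, hq, hdvd⟩ := (minpoly k x).exists_eq_pow_rootMultiplicity_mul_and_not_dvd
    (minpoly.ne_zero hx) 0
  rw [map_zero, sub_zero] at hq hdvd
  generalize Polynomial.rootMultiplicity 0 (minpoly k x) = n at hq
  -- The exponent n + 1 instead of n leaves a factor x to split off in the unit case, even when n =
  -- 0.
  have hco : IsCoprime ((Polynomial.X : Polynomial k) ^ (n + 1)) q :=
    IsCoprime.pow_left ((Polynomial.irreducible_X.coprime_iff_not_dvd).2 hdvd)
  obtain ⟨a, b, hab⟩ := hco
  have hxq : x ^ (n + 1) * Polynomial.aeval x q = 0 := by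
    have := minpoly.aeval k x
    rw [hq, map_mul, map_pow, Polynomial.aeval_X] at this
    rw [pow_succ', mul_assoc, this, mul_zero]
  have hsum : Polynomial.aeval x a * x ^ (n + 1) + Polynomial.aeval x b * Polynomial.aeval x q =
      1 := by
    simpa using congrArg (Polynomial.aeval x) hab
  have hcomm : ∀ p r : Polynomial k,
      Polynomial.aeval x p * Polynomial.aeval x r = Polynomial.aeval x r * Polynomial.aeval x p :=
    fun p r => by rw [← map_mul, mul_comm, map_mul]
  set s := Polynomial.aeval x a * x ^ (n + 1) with hs
  set t := Polynomial.aeval x b * Polynomial.aeval x q with ht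
  -- With s + t = 1 this makes s idempotent: s = 0 gives xⁿ⁺¹ = 0, and s = 1 exhibits an inverse of
  -- x.
  have hst : s * t = 0 := by
    rw [hs, ht, hcomm b q, mul_assoc, ← mul_assoc (x ^ (n + 1)), hxq, zero_mul, mul_zero]
  have hss : s * s = s := by
    have := congrArg (s * ·) hsum
    simpa only [mul_add, hst, add_zero, mul_one] using this
  rcases hE s hss with h | h
  · right
    refine ⟨n + 1, ?_⟩
    rw [h, zero_add] at hsum
    rw [← mul_one (x ^ (n + 1)), ← hsum, ht, hcomm b q, ← mul_assoc, hxq, zero_mul]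
  · left
    refine ⟨⟨x, Polynomial.aeval x a * x ^ n, ?_, ?_⟩, rfl⟩
    · have := hcomm Polynomial.X (a * Polynomial.X ^ n)
      simp only [map_mul, map_pow, Polynomial.aeval_X] at this
      rw [this, mul_assoc, ← pow_succ, ← hs, h]
    · rw [mul_assoc, ← pow_succ, ← hs, h]

/-! ### Indecomposable objects with finite-dimensional endomorphism algebra -/

section Local

variable {k : Type*} [Field k] {C : Type*} [Category C] [Preadditive C] [Linear k C]

/-- Fitting's lemma: idempotents split, so the endomorphism algebra has only trivial ones, and
finite dimension makes each endomorphism integral over k. -/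
theorem isIso_or_isNilpotent_of_indecomposable [IsIdempotentComplete C] [HasBinaryBiproducts C]
    {M : C} (hM : Indecomposable M) [Module.Finite k (End M)] (f : End M) :
    IsIso f ∨ IsNilpotent f := by
  rcases isUnit_or_isNilpotent (k := k) (E := End M)
      (fun e he => eq_zero_or_eq_id_of_indecomposable hM e he) f
    (Algebra.IsIntegral.isIntegral f) with h | h
  · exact Or.inl ((isUnit_iff_isIso f).1 h)
  · exact Or.inr h

theorem isIso_one_sub_of_isNilpotent {M : C} {f : End M} (hf : IsNilpotent f) :
    IsIso (𝟙 M - End.asHom f) :=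
  (isUnit_iff_isIso (𝟙 M - End.asHom f)).1 hf.isUnit_one_sub

variable (k) in
/-- A morphism between indecomposable objects that is not invertible is radical. -/
theorem isRadical_of_not_isIso [IsIdempotentComplete C] [HasBinaryBiproducts C] {M N : C}
    (hM : Indecomposable M) (hN : Indecomposable N) [Module.Finite k (End M)]
    (f : M ⟶ N) (hf : ¬ IsIso f) : IsRadical f := by
  intro g
  rcases isIso_or_isNilpotent_of_indecomposable (k := k) hM (f ≫ g) with h | h
  · exfalso
    have hfg : f ≫ g ≫ inv (f ≫ g) = 𝟙 M := by rw [← Category.assoc, IsIso.hom_inv_id]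
    -- If fg is invertible, f has a one-sided inverse and cuts out an idempotent of N. It is 0 only
    -- if M = 0, and it is 1 only if f is an isomorphism.
    have hid : ((g ≫ inv (f ≫ g)) ≫ f) ≫ (g ≫ inv (f ≫ g)) ≫ f = (g ≫ inv (f ≫ g)) ≫ f := by
      calc _ = g ≫ inv (f ≫ g) ≫ (f ≫ g ≫ inv (f ≫ g)) ≫ f := by simp only [Category.assoc]
        _ = _ := by rw [hfg, Category.id_comp, Category.assoc]
    rcases eq_zero_or_eq_id_of_indecomposable hN _ hid with h0 | h1
    · have h2 : f ≫ ((g ≫ inv (f ≫ g)) ≫ f) ≫ g ≫ inv (f ≫ g) = 𝟙 M := by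
        calc _ = (f ≫ g ≫ inv (f ≫ g)) ≫ f ≫ g ≫ inv (f ≫ g) := by simp only [Category.assoc]
          _ = _ := by rw [hfg, Category.id_comp]
      rw [h0, zero_comp, comp_zero] at h2
      exact hM.1 ((IsZero.iff_id_eq_zero M).2 h2.symm)
    · exact hf ⟨_, hfg, h1⟩
  · exact isIso_one_sub_of_isNilpotent h

theorem isRadical_of_ne [IsIdempotentComplete C] [HasBinaryBiproducts C] {ι : Type*}
    {X : ι → C} (hX : ∀ i, Indecomposable (X i)) [∀ i, Module.Finite k (End (X i))]
    (hXX : ∀ i i', i ≠ i' → IsEmpty (X i ≅ X i')) {i i' : ι} (h : i ≠ i') (f : X i ⟶ X i') :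
    IsRadical f :=
  isRadical_of_not_isIso k (hX i) (hX i') f fun _ => (hXX i i' h).false (asIso f)

variable (k) in
/-- Over an algebraically closed field the endomorphism algebra of an indecomposable object is
the sum of the scalars and the radical. -/
theorem exists_residue [IsAlgClosed k] [IsIdempotentComplete C] [HasBinaryBiproducts C] {M : C}
    (hM : Indecomposable M) [Module.Finite k (End M)] :
    ∃ l : (M ⟶ M) →ₗ[k] k, ∀ f : M ⟶ M, IsRadical (f - l f • 𝟙 M) := by
  let J : Submodule k (M ⟶ M) :=
    { carrier := {f | IsRadical f}
      add_mem' := fun hf hg => hf.add hg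
      zero_mem' := IsRadical.zero
      smul_mem' := fun c _ hf => hf.smul c }
  have h1 : (𝟙 M) ∉ J := fun h => hM.1 (isZero_of_isRadical_id h)
  -- Choosing a linear form that kills the radical endomorphisms but not the identity makes the
  -- residue linear from the start.
  obtain ⟨l, hl, hJ⟩ := Submodule.exists_le_ker_of_notMem h1
  have : Nontrivial (End M) := ⟨⟨𝟙 M, 0, fun h => hM.1 ((IsZero.iff_id_eq_zero M).2 h)⟩⟩
  have hc : ∀ f : M ⟶ M, ∃ c : k, IsRadical (f - c • 𝟙 M) := by
    intro f
    -- For c in the spectrum, f - c is not invertible and hence radical.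
    obtain ⟨c, hc⟩ := spectrum.nonempty_of_isAlgClosed_of_finiteDimensional k (End.of f)
    refine ⟨c, isRadical_of_not_isIso k hM hM _ fun h => hc ?_⟩
    have := ((isUnit_iff_isIso (f - c • 𝟙 M)).2 h).neg
    rw [neg_sub] at this
    rwa [spectrum.mem_resolventSet_iff, Algebra.algebraMap_eq_smul_one]
  refine ⟨(l (𝟙 M))⁻¹ • l, fun f => ?_⟩
  obtain ⟨c, hc⟩ := hc f
  have h0 : l (f - c • 𝟙 M) = 0 := hJ hc
  rw [map_sub, map_smul, sub_eq_zero] at h0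
  rw [LinearMap.smul_apply, h0, smul_eq_mul, smul_eq_mul, mul_comm, mul_assoc, mul_inv_cancel₀ hl,
    mul_one]
  exact hc

end Local

/-! ### Bundling modules and linear maps -/

section Bundle

variable {k : Type u} [Field k] {A : Type v} [Ring A] [Algebra k A]

variable (k A) in
/-- A finite-dimensional module as an object of `A`-mod. -/
def fd (M : Type u) [AddCommGroup M] [Module k M] [Module A M] [IsScalarTower k A M]
    [Module.Finite k M] : FdMod k A :=
  ⟨ModuleCat.of A M, by
    let _ : Module k (ModuleCat.of A M) := inferInstanceAs (Module k M)
    have : Module.Finite k (ModuleCat.of A M) := inferInstanceAs (Module.Finite k M)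
    exact isFd_of k A (ModuleCat.of A M) fun c x => algebraMap_smul A c (x : M)⟩

variable {M : Type u} [AddCommGroup M] [Module k M] [Module A M] [IsScalarTower k A M]
    [Module.Finite k M] {N : Type u} [AddCommGroup N] [Module k N] [Module A N]
    [IsScalarTower k A N] [Module.Finite k N]
    {L : Type u} [AddCommGroup L] [Module k L] [Module A L]
    [IsScalarTower k A L] [Module.Finite k L]

variable (k) in
/-- A linear map as a morphism of `A`-mod. -/
def fdHom (f : M →ₗ[A] N) : fd k A M ⟶ fd k A N := ObjectProperty.homMk (ModuleCat.ofHom f)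

theorem fdHom_comp (f : M →ₗ[A] N) (g : N →ₗ[A] L) : fdHom k (g ∘ₗ f) = fdHom k f ≫ fdHom k g :=
  rfl

theorem fdHom_add (f g : M →ₗ[A] N) : fdHom k (f + g) = fdHom k f + fdHom k g := rfl

theorem fdHom_sum {ι : Type*} (s : Finset ι) (f : ι → (M →ₗ[A] N)) :
    fdHom k (∑ i ∈ s, f i) = ∑ i ∈ s, fdHom k (f i) :=
  map_sum ({ toFun := fdHom k, map_zero' := rfl, map_add' := fdHom_add } :
    (M →ₗ[A] N) →+ (fd k A M ⟶ fd k A N)) f s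

variable {T S : FdMod k A}

theorem fdHom_ext {f g : T ⟶ S} (h : ∀ x, f.hom.hom x = g.hom.hom x) : f = g :=
  ObjectProperty.hom_ext _ (ModuleCat.hom_ext (LinearMap.ext h))

theorem sum_hom_apply {ι : Type*} (s : Finset ι) (f : ι → (T ⟶ S)) (x : T.obj) :
    (∑ i ∈ s, f i).hom.hom x = ∑ i ∈ s, (f i).hom.hom x :=
  map_sum ({ toFun := fun f => f.hom.hom x, map_zero' := rfl, map_add' := fun _ _ => rfl } :
    (T ⟶ S) →+ S.obj) f s

theorem smul_hom_apply (c : k) (f : T ⟶ S) (x : T.obj) :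
    (c • f).hom.hom x = c • f.hom.hom x := rfl

/-- The `k`-linear map underlying a morphism of `A`-mod. -/
def toLin (T S : FdMod k A) : (T ⟶ S) →ₗ[k] (T.obj →ₗ[k] S.obj) where
  toFun f := f.hom.hom.restrictScalars k
  map_add' _ _ := rfl
  map_smul' _ _ := rfl

instance (T S : FdMod k A) : Module.Finite k (T ⟶ S) :=
  Module.Finite.of_injective (toLin T S) fun _ _ h =>
    fdHom_ext fun x => LinearMap.congr_fun h x

instance (T : FdMod k A) : Module.Finite k (End T) := inferInstanceAs (Module.Finite k (T ⟶ T))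

theorem isIso_of_bijective (f : T ⟶ S) (h : Function.Bijective f.hom.hom) : IsIso f := by
  rw [← ObjectProperty.isIso_hom_iff]
  exact (ConcreteCategory.isIso_iff_bijective f.hom).2 h

theorem bijective_of_isIso (f : T ⟶ S) [IsIso f] : Function.Bijective f.hom.hom :=
  (ConcreteCategory.isIso_iff_bijective f.hom).1 inferInstance

end Bundle

/-! ### The modules `⨁ U_i ⊗ V_i` -/

section SumTensor

variable {k : Type u} [Field k] {A : Type v} [Ring A] [Algebra k A]
variable {m : ℕ} (U : Fin m → FdMod k A) (V : Fin m → FGModuleCat.{u} k)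

variable {V} in
/-- The map `U_i → ⨁ U_i ⊗ V_i`, `x ↦ x ⊗ v`. -/
def inc (i : Fin m) (v : V i) : (U i).obj →ₗ[A] SumTensor U V where
  toFun x := Pi.single i (x ⊗ₜ[k] v)
  map_add' x y := by rw [TensorProduct.add_tmul, Pi.single_add]
  map_smul' a x := by rw [RingHom.id_apply, ← Pi.single_smul, TensorProduct.smul_tmul']

/-- The contraction `P ⊗ W → P` with a linear form on `W`. -/
def contract (P : FdMod k A) {W : FGModuleCat.{u} k} (ξ : W →ₗ[k] k) :
    P.obj ⊗[k] W →ₗ[A] P.obj :=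
  (TensorProduct.AlgebraTensorModule.rid k A P.obj).toLinearMap ∘ₗ
    TensorProduct.AlgebraTensorModule.map (LinearMap.id : P.obj →ₗ[A] P.obj) ξ

theorem contract_tmul (P : FdMod k A) {W : FGModuleCat.{u} k} (ξ : W →ₗ[k] k) (x : P.obj) (v : W) :
    contract P ξ (x ⊗ₜ v) = ξ v • x := by
  simp [contract]

/-- Expansion of the second tensor factor in a basis; the coefficients are contractions with the
dual basis. -/
theorem sum_contract_tmul (P : FdMod k A) {W : FGModuleCat.{u} k} {ι : Type*} [Fintype ι]
    (b : Module.Basis ι k W) (y : P.obj ⊗[k] W) :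
    ∑ t, contract P (b.coord t) y ⊗ₜ[k] b t = y := by
  induction y using TensorProduct.induction_on with
  | zero => simp
  | tmul x v =>
    simp only [contract_tmul, TensorProduct.smul_tmul]
    rw [← TensorProduct.tmul_sum]
    congr 1
    exact b.sum_repr v
  | add x y hx hy =>
    simp only [map_add, TensorProduct.add_tmul, Finset.sum_add_distrib, hx, hy]

variable {V} in
/-- The map `⨁ U_i ⊗ V_i → U_i` given by a linear form on `V_i`. -/
def prj (i : Fin m) (ξ : V i →ₗ[k] k) : SumTensor U V →ₗ[A] (U i).obj :=
  contract (U i) ξ ∘ₗ LinearMap.proj i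

variable {V}

theorem inc_apply (i : Fin m) (v : V i) (x : (U i).obj) :
    inc U i v x = Pi.single i (x ⊗ₜ[k] v) := rfl

theorem prj_apply (i : Fin m) (ξ : V i →ₗ[k] k) (z : SumTensor U V) :
    prj U i ξ z = contract (U i) ξ (z i) := rfl

theorem prj_inc_same (i : Fin m) (ξ : V i →ₗ[k] k) (v : V i) (x : (U i).obj) :
    prj U i ξ (inc U i v x) = ξ v • x := by
  rw [prj_apply, inc_apply, Pi.single_eq_same, contract_tmul]

variable (V) in
/-- The index set of a decomposition of `⨁ U_i ⊗ V_i` into copies of the `U_i`. -/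
abbrev SumIdx : Type := Σ i : Fin m, Fin (Module.finrank k (V i))

/-- The vector of the chosen basis of `V_i`. -/
noncomputable abbrev vec (p : SumIdx V) : V p.1 := Module.finBasis k (V p.1) p.2

/-- The linear form of the basis dual to the chosen basis of `V_i`. -/
noncomputable abbrev covec (p : SumIdx V) : V p.1 →ₗ[k] k := (Module.finBasis k (V p.1)).coord p.2

/-- Resolves the identity of ⨁ U_i ⊗ V_i into maps through single U_i. It replaces an isomorphism
with a direct sum of copies, while `inc` and `prj` stay linear in arbitrary vectors and forms. -/
theorem sum_inc_prj (z : SumTensor U V) :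
    ∑ p : SumIdx V, inc U p.1 (vec p) (prj U p.1 (covec p) z) = z := by
  rw [Fintype.sum_sigma]
  have h : ∀ i, ∑ t, inc U i (Module.finBasis k (V i) t)
      (prj U i ((Module.finBasis k (V i)).coord t) z) = Pi.single i (z i) := by
    intro i
    simp only [inc_apply]
    rw [← sum_contract_tmul (U i) (Module.finBasis k (V i)) (z i)]
    exact (map_sum (AddMonoidHom.single (fun i => (U i).obj ⊗[k] V i) i) _ _).symm
  rw [Finset.sum_congr rfl fun i _ => h i]
  exact Finset.univ_sum_single z

theorem sum_inc_comp_prj :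
    ∑ p : SumIdx V, inc U p.1 (vec p) ∘ₗ prj U p.1 (covec p) =
      (LinearMap.id : SumTensor U V →ₗ[A] SumTensor U V) :=
  LinearMap.ext fun z => by
    rw [LinearMap.sum_apply]
    exact sum_inc_prj U z

theorem inc_add (i : Fin m) (v w : V i) : inc U i (v + w) = inc U i v + inc U i w :=
  LinearMap.ext fun x => by
    rw [LinearMap.add_apply, inc_apply, TensorProduct.tmul_add, Pi.single_add]
    rfl

theorem inc_smul (i : Fin m) (c : k) (v : V i) (x : (U i).obj) :
    inc U i (c • v) x = c • inc U i v x := by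
  rw [inc_apply, inc_apply, ← Pi.single_smul, TensorProduct.tmul_smul]

variable {V' : Fin m → FGModuleCat.{u} k} (f : ∀ i, V i →ₗ[k] V' i)

theorem sumTensorMap_inc (i : Fin m) (v : V i) (x : (U i).obj) :
    sumTensorMap U f (inc U i v x) = inc U i (f i v) x := by
  funext i'
  by_cases h : i = i'
  · subst h
    simp [sumTensorMap, inc_apply]
  · simp [sumTensorMap, inc_apply, Pi.single_eq_of_ne' h]

theorem prj_sumTensorMap (i : Fin m) (ξ : V' i →ₗ[k] k) (z : SumTensor U V) :
    prj U i ξ (sumTensorMap U f z) = prj U i (ξ ∘ₗ f i) z := by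
  simp only [prj, contract, sumTensorMap, LinearMap.comp_apply, LinearMap.pi_apply,
    LinearMap.proj_apply]
  congr 1
  rw [← LinearMap.comp_apply, ← TensorProduct.AlgebraTensorModule.map_comp, LinearMap.comp_id]

/-- `⨁ U_i ⊗ V_i` lies in `add (⨁ U_i)`. -/
theorem addCat_sumTensor : addCat (⨁ U) (fd k A (SumTensor U V)) := by
  let P : ∀ p : SumIdx V, fd k A (SumTensor U V) ⟶ U p.1 := fun p =>
    fdHom k (prj U p.1 (covec p))
  let I : ∀ p : SumIdx V, U p.1 ⟶ fd k A (SumTensor U V) := fun p =>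
    fdHom k (inc U p.1 (vec p))
  refine addCat_of_sum (ι := SumIdx V) (fun p => P p ≫ biproduct.ι U p.1)
    (fun p => biproduct.π U p.1 ≫ I p) ?_
  simp only [Category.assoc, biproduct.ι_π_self_assoc]
  have := congrArg (fdHom k) (sum_inc_comp_prj U (V := V))
  rw [fdHom_sum] at this
  exact this

end SumTensor

/-! ### Cocycles and extensions -/

section Cocycle

set_option linter.unusedSectionVars false

variable {k : Type u} [Field k] {A : Type v} [Ring A] [Algebra k A]
variable {N : Type u} [AddCommGroup N] [Module k N] [Module A N] [IsScalarTower k A N]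
variable {M : Type u} [AddCommGroup M] [Module k M] [Module A M] [IsScalarTower k A M]
variable {N' : Type u} [AddCommGroup N'] [Module k N'] [Module A N'] [IsScalarTower k A N']
variable {M' : Type u} [AddCommGroup M'] [Module k M'] [Module A M'] [IsScalarTower k A M']

theorem cocycle_ext {ζ ζ' : Z k A N M} (h : ∀ a y, ζ.1 a y = ζ'.1 a y) : ζ = ζ' :=
  Subtype.ext (LinearMap.ext fun a => LinearMap.ext fun y => h a y)

theorem push_apply (f : M →ₗ[A] M') (ζ : Z k A N M) (a : A) (y : N) :
    (push f ζ).1 a y = f (ζ.1 a y) := rfl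

theorem pull_apply (ζ : Z k A N M) (g : N' →ₗ[A] N) (a : A) (y : N') :
    (pull ζ g).1 a y = ζ.1 a (g y) := rfl

theorem d_apply (r : N →ₗ[k] M) (a : A) (y : N) : (d k A N M r).1 a y = a • r y - r (a • y) := rfl

theorem sub_apply (ζ ζ' : Z k A N M) (a : A) (y : N) :
    (ζ - ζ').1 a y = ζ.1 a y - ζ'.1 a y := rfl

theorem add_apply (ζ ζ' : Z k A N M) (a : A) (y : N) :
    (ζ + ζ').1 a y = ζ.1 a y + ζ'.1 a y := rfl

theorem smul_apply (c : k) (ζ : Z k A N M) (a : A) (y : N) :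
    (c • ζ).1 a y = c • ζ.1 a y := rfl

theorem sum_apply {ι : Type*} (s : Finset ι) (ζ : ι → Z k A N M) (a : A) (y : N) :
    (∑ i ∈ s, ζ i).1 a y = ∑ i ∈ s, (ζ i).1 a y :=
  map_sum ({ toFun := fun ζ => ζ.1 a y, map_zero' := rfl, map_add' := fun _ _ => rfl } :
    Z k A N M →+ M) ζ s

theorem cocycle_sub_mem (S : Submodule k (Z k A N M)) {ζ ζ' : Z k A N M} (h : ζ ∈ S)
    (h' : ζ' ∈ S) : ζ - ζ' ∈ S := by
  have e : ζ - ζ' = ζ + (-1 : k) • ζ' := cocycle_ext fun a y => by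
    rw [sub_apply, add_apply, smul_apply, neg_one_smul, sub_eq_add_neg]
  rw [e]
  exact S.add_mem h (S.smul_mem _ h')

theorem push_mem_B (f : M →ₗ[A] M') {ζ : Z k A N M} (h : ζ ∈ B k A N M) :
    push f ζ ∈ B k A N M' := by
  obtain ⟨r, rfl⟩ := h
  exact ⟨f.restrictScalars k ∘ₗ r, cocycle_ext fun a y => by simp [push_apply, d_apply]⟩

theorem pull_mem_B (g : N' →ₗ[A] N) {ζ : Z k A N M} (h : ζ ∈ B k A N M) :
    pull ζ g ∈ B k A N' M := by
  obtain ⟨r, rfl⟩ := h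
  exact ⟨r ∘ₗ g.restrictScalars k, cocycle_ext fun a y => by simp [pull_apply, d_apply]⟩

variable [Module.Finite k M] [Module.Finite k N] [Module.Finite k M'] [Module.Finite k N']

theorem ext_smul (ζ : Z k A N M) (a : A) (p : (ext ζ).obj) :
    a • p = ((a • (p : M × N).1 + ζ.1 a (p : M × N).2, a • (p : M × N).2) : M × N) := rfl

/-- On an object of A-mod, k acts through `algebraMap`; the action is componentwise since cocycles
vanish on scalars. -/
theorem ext_smul' (ζ : Z k A N M) (c : k) (p : (ext ζ).obj) :
    c • p = ((c • (p : M × N).1, c • (p : M × N).2) : M × N) := by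
  change algebraMap k A c • p = _
  rw [ext_smul, map_algebraMap, LinearMap.zero_apply, add_zero, algebraMap_smul, algebraMap_smul]

/-- The inclusion of the left end of an extension. -/
def extInl (ζ : Z k A N M) : M →ₗ[A] (ext ζ).obj where
  toFun x := ((x, 0) : M × N)
  map_add' x y := Prod.ext rfl (add_zero (0 : N)).symm
  map_smul' a x := by
    change ((a • x, 0) : M × N) = (a • x + ζ.1 a 0, a • (0 : N))
    rw [map_zero, add_zero, smul_zero]

/-- The projection to the right end of an extension. -/
def extSnd (ζ : Z k A N M) : (ext ζ).obj →ₗ[A] N where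
  toFun p := (p : M × N).2
  map_add' _ _ := rfl
  map_smul' _ _ := rfl

/-- The identity `f ζ - ζ' g = d t`, which makes the matrix `[f, t; 0, g]` a morphism. -/
def IsTri (ζ : Z k A N M) (ζ' : Z k A N' M') (f : M →ₗ[A] M') (g : N →ₗ[A] N')
    (t : N →ₗ[k] M') : Prop :=
  ∀ a y, f (ζ.1 a y) - ζ'.1 a (g y) = a • t y - t (a • y)

/-- The linear map of extensions given by the matrix `[f, t; 0, g]`. -/
def triLin (ζ : Z k A N M) (ζ' : Z k A N' M') (f : M →ₗ[A] M') (g : N →ₗ[A] N') (t : N →ₗ[k] M')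
    (h : IsTri ζ ζ' f g t) : (ext ζ).obj →ₗ[A] (ext ζ').obj where
  toFun p := ((f (p : M × N).1 + t (p : M × N).2, g (p : M × N).2) : M' × N')
  map_add' p q := by
    refine Prod.ext ?_ (map_add g _ _)
    change f ((p : M × N).1 + (q : M × N).1) + t ((p : M × N).2 + (q : M × N).2) =
      (f (p : M × N).1 + t (p : M × N).2) + (f (q : M × N).1 + t (q : M × N).2)
    rw [map_add, map_add]
    abel
  map_smul' a p := by
    refine Prod.ext ?_ (map_smul g _ _)
    have h' := h a (p : M × N).2
    change f (a • (p : M × N).1 + ζ.1 a (p : M × N).2) + t (a • (p : M × N).2) =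
      a • (f (p : M × N).1 + t (p : M × N).2) + ζ'.1 a (g (p : M × N).2)
    rw [sub_eq_iff_eq_add] at h'
    rw [map_add, map_smul, smul_add, h']
    abel

/-- The morphism of extensions given by the matrix `[f, t; 0, g]`. -/
def triHom (ζ : Z k A N M) (ζ' : Z k A N' M') (f : M →ₗ[A] M') (g : N →ₗ[A] N') (t : N →ₗ[k] M')
    (h : IsTri ζ ζ' f g t) : ext ζ ⟶ ext ζ' :=
  let q := ModuleCat.ofHom (triLin ζ ζ' f g t h)
  ObjectProperty.homMk q

theorem triHom_apply (ζ : Z k A N M) (ζ' : Z k A N' M') (f : M →ₗ[A] M') (g : N →ₗ[A] N')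
    (t : N →ₗ[k] M') (h : IsTri ζ ζ' f g t) (p : (ext ζ).obj) :
    (triHom ζ ζ' f g t h).hom.hom p =
      ((f (p : M × N).1 + t (p : M × N).2, g (p : M × N).2) : M' × N') := rfl

/-- If there are no maps from the left end to the right end, every morphism of extensions is upper
triangular. -/
theorem exists_triHom (ζ : Z k A N M) (ζ' : Z k A N' M') (h0 : ∀ f : M →ₗ[A] N', f = 0)
    (q : ext ζ ⟶ ext ζ') :
    ∃ (f : M →ₗ[A] M') (g : N →ₗ[A] N') (t : N →ₗ[k] M')
      (h : IsTri ζ ζ' f g t), q = triHom ζ ζ' f g t h := by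
  let Q : M × N → M' × N' := fun p => q.hom.hom p
  have hadd : ∀ p p', Q (p + p') = Q p + Q p' := fun p p' => map_add q.hom.hom p p'
  have hA : ∀ (a : A) (p : M × N), Q (a • p.1 + ζ.1 a p.2, a • p.2) =
      (a • (Q p).1 + ζ'.1 a (Q p).2, a • (Q p).2) := fun a p =>
    q.hom.hom.map_smul a (p : (ext ζ).obj)
  -- A-linearity at the scalars, where both cocycles vanish, gives k-linearity; the corner t needs
  -- it.
  have hk : ∀ (c : k) (p : M × N), Q (c • p) = c • Q p := fun c p => by
    have := hA (algebraMap k A c) p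
    rw [map_algebraMap, map_algebraMap, LinearMap.zero_apply, LinearMap.zero_apply, add_zero,
      add_zero, algebraMap_smul, algebraMap_smul, algebraMap_smul, algebraMap_smul] at this
    exact this
  -- The lower left corner is A-linear, since the inclusion of M and the projection to N' are; hence
  -- it vanishes.
  let e : M →ₗ[A] N' :=
    { toFun := fun x => (Q (x, 0)).2
      map_add' := fun x y => by
        rw [← Prod.snd_add, ← hadd, Prod.mk_add_mk, add_zero]
      map_smul' := fun a x => by
        have := congrArg Prod.snd (hA a (x, 0))
        simpa using this }
  have he : ∀ x, (Q (x, 0)).2 = 0 := fun x => LinearMap.congr_fun (h0 e) x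
  have hsum : ∀ p, Q p = Q (p.1, 0) + Q (0, p.2) := fun p => by
    rw [← hadd, Prod.mk_add_mk, add_zero, zero_add]
  -- Evaluation at a • (0, y) = (ζ(a)y, a y): its second component makes g linear over A, its first
  -- is the triangular identity.
  have hs : ∀ a y, Q (0, a • y) = (a • (Q (0, y)).1 + ζ'.1 a (Q (0, y)).2, a • (Q (0, y)).2) -
      Q (ζ.1 a y, 0) := fun a y => by
    have h1 := hA a (0, y)
    rw [hsum, smul_zero, zero_add] at h1
    rw [← h1, add_sub_cancel_left]
  let f : M →ₗ[A] M' :=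
    { toFun := fun x => (Q (x, 0)).1
      map_add' := fun x y => by
        rw [← Prod.fst_add, ← hadd, Prod.mk_add_mk, add_zero]
      map_smul' := fun a x => by
        have := congrArg Prod.fst (hA a (x, 0))
        simpa [he] using this }
  let g : N →ₗ[A] N' :=
    { toFun := fun y => (Q (0, y)).2
      map_add' := fun x y => by
        rw [← Prod.snd_add, ← hadd, Prod.mk_add_mk, add_zero]
      map_smul' := fun a y => by
        rw [hs, Prod.snd_sub, he, sub_zero, RingHom.id_apply] }
  let t : N →ₗ[k] M' :=
    { toFun := fun y => (Q (0, y)).1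
      map_add' := fun x y => by
        rw [← Prod.fst_add, ← hadd, Prod.mk_add_mk, add_zero]
      map_smul' := fun c y => by
        rw [RingHom.id_apply, ← Prod.smul_fst, ← hk, Prod.smul_mk, smul_zero] }
  have hT : IsTri ζ ζ' f g t := by
    intro a y
    have := congrArg Prod.fst (hs a y)
    change (Q (ζ.1 a y, 0)).1 - ζ'.1 a (Q (0, y)).2 = a • (Q (0, y)).1 - (Q (0, a • y)).1
    rw [Prod.fst_sub] at this
    rw [this]
    dsimp only
    abel
  refine ⟨f, g, t, hT, fdHom_ext fun p => ?_⟩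
  have := hsum p
  change Q p = ((f (p : M × N).1 + t (p : M × N).2, g (p : M × N).2) : M' × N')
  rw [this]
  exact Prod.ext rfl (by
    rw [Prod.snd_add, he, zero_add]
    rfl)

/-- A triangular morphism with invertible diagonal is invertible. -/
theorem bijective_triangular {f : M →ₗ[A] M'} {g : N →ₗ[A] N'} {t : N →ₗ[k] M'}
    (hf : Function.Bijective f) (hg : Function.Bijective g) :
    Function.Bijective (fun p : M × N => (f p.1 + t p.2, g p.2)) := by
  constructor
  · intro p q h
    have h2 := hg.1 (congrArg Prod.snd h)
    have h1 := congrArg Prod.fst h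
    simp only [h2, add_left_inj] at h1
    exact Prod.ext (hf.1 h1) h2
  · rintro ⟨x, y⟩
    obtain ⟨y', rfl⟩ := hg.2 y
    obtain ⟨x', hx'⟩ := hf.2 (x - t y')
    exact ⟨(x', y'), by simp [hx']⟩

/-- A triangular morphism with radical diagonal is radical. -/
theorem isRadical_triHom (ζ : Z k A N M) (ζ' : Z k A N' M') (h0 : ∀ f : M' →ₗ[A] N, f = 0)
    (f : M →ₗ[A] M') (g : N →ₗ[A] N') (t : N →ₗ[k] M')
    (h : IsTri ζ ζ' f g t) (hf : IsRadical (fdHom k f))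
    (hg : IsRadical (fdHom k g)) : IsRadical (triHom ζ ζ' f g t h) := by
  intro q
  -- The test morphism is triangular as well, so 1 minus the composite has diagonal 1 - f'f, 1 -
  -- g'g, both invertible.
  obtain ⟨f', g', t', h', rfl⟩ := exists_triHom ζ' ζ h0 q
  have hf1 := hf (fdHom k f')
  have hg1 := hg (fdHom k g')
  have hf2 : Function.Bijective (LinearMap.id - f' ∘ₗ f : M →ₗ[A] M) :=
    bijective_of_isIso (𝟙 _ - fdHom k f ≫ fdHom k f')
  have hg2 : Function.Bijective (LinearMap.id - g' ∘ₗ g : N →ₗ[A] N) :=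
    bijective_of_isIso (𝟙 _ - fdHom k g ≫ fdHom k g')
  apply isIso_of_bijective
  have key := bijective_triangular hf2 hg2
    (t := -(f'.restrictScalars k ∘ₗ t + t' ∘ₗ g.restrictScalars k))
  let D : ext ζ ⟶ ext ζ := 𝟙 _ - triHom ζ ζ' f g t h ≫ triHom ζ' ζ f' g' t' h'
  suffices e : (D.hom.hom : M × N → M × N) = fun p : M × N =>
      ((LinearMap.id - f' ∘ₗ f : M →ₗ[A] M) p.1 +
        (-(f'.restrictScalars k ∘ₗ t + t' ∘ₗ g.restrictScalars k) : N →ₗ[k] M) p.2,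
        (LinearMap.id - g' ∘ₗ g : N →ₗ[A] N) p.2) by
    rw [← e] at key
    exact key
  funext p
  refine Prod.ext ?_ rfl
  change (p : M × N).1 - (f' (f (p : M × N).1 + t (p : M × N).2) + t' (g (p : M × N).2)) =
    (p : M × N).1 - f' (f (p : M × N).1) + -(f' (t (p : M × N).2) + t' (g (p : M × N).2))
  rw [map_add]
  abel

theorem isIso_triHom (ζ : Z k A N M) (ζ' : Z k A N' M')
    (f : M →ₗ[A] M') (g : N →ₗ[A] N') (t : N →ₗ[k] M')
    (h : IsTri ζ ζ' f g t) (hf : Function.Bijective f)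
    (hg : Function.Bijective g) : IsIso (triHom ζ ζ' f g t h) :=
  isIso_of_bijective _ (bijective_triangular hf hg)

end Cocycle

/-! ### Radical maps between sums of tensor products -/

section Residue

variable {k : Type u} [Field k] {A : Type v} [Ring A] [Algebra k A]
variable {m : ℕ} (U : Fin m → FdMod k A) {V V' : Fin m → FGModuleCat.{u} k}

/-- The `(q, p)` entry of a map `⨁ U_i ⊗ V_i → ⨁ U_i ⊗ V'_i` at vectors and linear forms. -/
def entry (f : SumTensor U V →ₗ[A] SumTensor U V') (i i' : Fin m) (v : V i) (ξ : V' i' →ₗ[k] k) :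
    U i ⟶ U i' :=
  fdHom k (prj U i' ξ ∘ₗ f ∘ₗ inc U i v)

theorem entry_apply (f : SumTensor U V →ₗ[A] SumTensor U V') (i i' : Fin m) (v : V i)
    (ξ : V' i' →ₗ[k] k) (x : (U i).obj) :
    (entry U f i i' v ξ).hom.hom x = prj U i' ξ (f (inc U i v x)) := rfl

theorem entry_add (f : SumTensor U V →ₗ[A] SumTensor U V') (i i' : Fin m) (v w : V i)
    (ξ : V' i' →ₗ[k] k) : entry U f i i' (v + w) ξ = entry U f i i' v ξ + entry U f i i' w ξ := by
  refine fdHom_ext fun x => ?_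
  change prj U i' ξ (f (inc U i (v + w) x)) =
    prj U i' ξ (f (inc U i v x)) + prj U i' ξ (f (inc U i w x))
  rw [inc_add, LinearMap.add_apply, map_add, map_add]

theorem entry_smul (f : SumTensor U V →ₗ[A] SumTensor U V') (i i' : Fin m) (c : k) (v : V i)
    (ξ : V' i' →ₗ[k] k) : entry U f i i' (c • v) ξ = c • entry U f i i' v ξ := by
  refine fdHom_ext fun x => ?_
  rw [smul_hom_apply, entry_apply, entry_apply, inc_smul, ← algebraMap_smul A, map_smul, map_smul,
    algebraMap_smul]

/-- The map is the sum of its entries placed between `inc` and `prj`, and radical morphisms form an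
ideal. -/
theorem isRadical_of_entry (f : SumTensor U V →ₗ[A] SumTensor U V')
    (h : ∀ (p : SumIdx V) (q : SumIdx V'), IsRadical (entry U f p.1 q.1 (vec p) (covec q))) :
    IsRadical (fdHom k f) := by
  have hf : f = ∑ q : SumIdx V', ∑ p : SumIdx V, inc U q.1 (vec q) ∘ₗ
      (prj U q.1 (covec q) ∘ₗ f ∘ₗ inc U p.1 (vec p)) ∘ₗ prj U p.1 (covec p) := by
    refine LinearMap.ext fun z => ?_
    simp only [LinearMap.sum_apply, LinearMap.comp_apply]
    simp only [← map_sum]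
    rw [sum_inc_prj U z, sum_inc_prj U (f z)]
  rw [hf, fdHom_sum]
  refine IsRadical.sum _ fun q _ => ?_
  rw [fdHom_sum]
  refine IsRadical.sum _ fun p _ => ?_
  rw [fdHom_comp, fdHom_comp]
  exact (IsRadical.comp_left (h p q) _).comp_right _

theorem hom_eq_zero_of_entry {P : Type u} [AddCommGroup P] [Module A P]
    (f : SumTensor U V →ₗ[A] P) (h : ∀ (p : SumIdx V), f ∘ₗ inc U p.1 (vec p) = 0) : f = 0 := by
  refine LinearMap.ext fun z => ?_
  rw [← sum_inc_prj U z, map_sum]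
  exact Finset.sum_eq_zero fun p _ => LinearMap.congr_fun (h p) _

theorem sumTensor_eq_zero (z : SumTensor U V)
    (h : ∀ (p : SumIdx V), prj U p.1 (covec p) z = 0) : z = 0 := by
  rw [← sum_inc_prj U z]
  exact Finset.sum_eq_zero fun p _ => by rw [h p, map_zero]

/-- If there are no nonzero maps `U_i → U'_j`, there are none `⨁ U_i ⊗ V_i → ⨁ U'_j ⊗ W_j`. -/
theorem sumTensor_hom_eq_zero {m' : ℕ} {U' : Fin m' → FdMod k A} {W : Fin m' → FGModuleCat.{u} k}
    (h0 : ∀ i j (f : U i ⟶ U' j), f = 0) (f : SumTensor U V →ₗ[A] SumTensor U' W) : f = 0 := by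
  refine hom_eq_zero_of_entry U f fun p => LinearMap.ext fun x =>
    sumTensor_eq_zero U' _ fun q => ?_
  exact congrArg (fun g => g.hom.hom x)
    (h0 p.1 q.1 (fdHom k (prj U' q.1 (covec q) ∘ₗ f ∘ₗ inc U p.1 (vec p))))

theorem entry_sub_sumTensorMap (f : SumTensor U V →ₗ[A] SumTensor U V')
    (φ : ∀ i, V i →ₗ[k] V' i) (i i' : Fin m) (v : V i) (ξ : V' i' →ₗ[k] k) (x : (U i).obj) :
    (entry U (f - sumTensorMap U φ) i i' v ξ).hom.hom x =
      (entry U f i i' v ξ).hom.hom x - prj U i' ξ (inc U i (φ i v) x) := by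
  rw [entry_apply, entry_apply, LinearMap.sub_apply, map_sub, sumTensorMap_inc]

/-- Modulo the radical every map `⨁ U_i ⊗ V_i → ⨁ U_i ⊗ V'_i` has the form `⨁ id ⊗ φ_i`. -/
theorem exists_sumTensorMap_isRadical [IsAlgClosed k] (hU : ∀ i, Indecomposable (U i))
    (hUU : ∀ i i', i ≠ i' → IsEmpty (U i ≅ U i')) (f : SumTensor U V →ₗ[A] SumTensor U V') :
    ∃ φ : ∀ i, V i →ₗ[k] V' i, IsRadical (fdHom k (f - sumTensorMap U φ)) := by
  choose l hl using fun i => exists_residue k (hU i)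
  -- The coordinates of φ_i(v) are the residues of the diagonal entries at v. Only V'_i needs a
  -- basis, as entries are linear in v.
  let φ : ∀ i, V i →ₗ[k] V' i := fun i =>
    { toFun := fun v => ∑ t, l i (entry U f i i v ((Module.finBasis k (V' i)).coord t)) •
        Module.finBasis k (V' i) t
      map_add' := fun v w => by
        simp only [entry_add, map_add, add_smul, Finset.sum_add_distrib]
      map_smul' := fun c v => by
        simp only [entry_smul, map_smul, smul_eq_mul, mul_smul, Finset.smul_sum, RingHom.id_apply] }
  have hφ : ∀ i v t, (Module.finBasis k (V' i)).coord t (φ i v) =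
      l i (entry U f i i v ((Module.finBasis k (V' i)).coord t)) := fun i v t => by
    simp [φ, Finsupp.single_apply]
  refine ⟨φ, isRadical_of_entry U _ fun ⟨i, t⟩ ⟨i', t'⟩ => ?_⟩
  by_cases h : i = i'
  · subst h
    have e : entry U (f - sumTensorMap U φ) i i (vec ⟨i, t⟩) (covec ⟨i, t'⟩) =
        entry U f i i (vec ⟨i, t⟩) ((Module.finBasis k (V' i)).coord t') -
          l i (entry U f i i (vec ⟨i, t⟩) ((Module.finBasis k (V' i)).coord t')) • 𝟙 (U i) := by
      refine fdHom_ext fun x => ?_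
      rw [entry_sub_sumTensorMap, prj_inc_same, hφ]
      rfl
    rw [e]
    exact hl i _
  · exact isRadical_of_ne (k := k) hU hUU h _

end Residue

/-! ### Representations of the bipartite quiver -/

section Rep

variable {k : Type u} [Field k] {r s : ℕ} {n : Fin r → Fin s → ℕ}

/-- A morphism of representations from its components. -/
def repHom {M M' : KRep k n} (φ : ∀ i, atX M i →ₗ[k] atX M' i) (ψ : ∀ j, atY M j →ₗ[k] atY M' j)
    (h : ∀ i j l, φ i ∘ₗ act M l = act M' (i := i) (j := j) l ∘ₗ ψ j) : M ⟶ M' :=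
  Paths.liftNatTrans
    (fun
      | .y j => (FGModuleCat.ofHom (ψ j) : atY M j ⟶ atY M' j)
      | .x i => (FGModuleCat.ofHom (φ i) : atX M i ⟶ atX M' i))
    (fun {a b} f => match a, b, f with
      | .y j, .x i, f => FGModuleCat.hom_ext (h i j f))

theorem rep_hom_ext {M M' : KRep k n} {f g : M ⟶ M'}
    (hx : ∀ i, (f.app ((Paths.of (BipQuiver n)).obj (.x i))).hom.hom =
      (g.app ((Paths.of (BipQuiver n)).obj (.x i))).hom.hom)
    (hy : ∀ j, (f.app ((Paths.of (BipQuiver n)).obj (.y j))).hom.hom =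
      (g.app ((Paths.of (BipQuiver n)).obj (.y j))).hom.hom) : f = g := by
  refine NatTrans.ext (funext fun a => ?_)
  match a with
  | .y j => exact FGModuleCat.hom_ext (hy j)
  | .x i => exact FGModuleCat.hom_ext (hx i)

/-- The spaces of a representation at the vertices. -/
def repObjMap (V : Fin r → FGModuleCat.{u} k) (W : Fin s → FGModuleCat.{u} k) :
    BipQuiver n → FGModuleCat.{u} k
  | .y j => W j
  | .x i => V i

/-- A representation from its spaces and maps. -/
def repMk (V : Fin r → FGModuleCat.{u} k) (W : Fin s → FGModuleCat.{u} k)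
    (c : ∀ i j, Fin (n i j) → (W j →ₗ[k] V i)) : KRep k n :=
  Paths.lift
    { obj := repObjMap V W
      map := fun {a b} f => match a, b, f with
        | .y j, .x i, f => (FGModuleCat.ofHom (c i j f) : W j ⟶ V i) }

end Rep

/-! ### The entries of `Θ` -/

section Theta

variable {k : Type u} [Field k] {A : Type v} [Ring A] [Algebra k A]
variable {r s : ℕ} (X : Fin r → FdMod k A) (Y : Fin s → FdMod k A) {n : Fin r → Fin s → ℕ}
  (ζ : ∀ i j, Fin (n i j) → Z k A (Y j).obj (X i).obj)
  {W : Fin s → FGModuleCat.{u} k} {V : Fin r → FGModuleCat.{u} k}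

theorem theta_apply (c : ∀ i j, Fin (n i j) → (W j →ₗ[k] V i)) (a : A) (w : SumTensor Y W)
    (i : Fin r) : (theta X Y ζ c).1 a w i =
      ∑ j, ∑ l, TensorProduct.map ((ζ i j l).1 a) (c i j l) (w j) := by
  simp [theta]

theorem theta_inc (c : ∀ i j, Fin (n i j) → (W j →ₗ[k] V i)) (a : A) (i : Fin r) (j : Fin s)
    (w : W j) (y : (Y j).obj) :
    (theta X Y ζ c).1 a (inc Y j w y) i = ∑ l, (ζ i j l).1 a y ⊗ₜ[k] c i j l w := by
  rw [theta_apply, Finset.sum_eq_single j]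
  · simp [inc_apply]
  · intro j' _ h
    simp [inc_apply, Pi.single_eq_of_ne h]
  · simp

/-- This is how the maps of a representation are recovered: each entry of Θ(c) is a combination of
the chosen cocycles whose coefficients are the matrix coefficients of c. -/
theorem push_pull_theta (c : ∀ i j, Fin (n i j) → (W j →ₗ[k] V i)) (i : Fin r) (j : Fin s)
    (w : W j) (ξ : V i →ₗ[k] k) :
    push (prj X i ξ) (pull (theta X Y ζ c) (inc Y j w)) = ∑ l, ξ (c i j l w) • ζ i j l := by
  refine cocycle_ext fun a y => ?_
  rw [push_apply, pull_apply, prj_apply, theta_inc, map_sum, sum_apply]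
  exact Finset.sum_congr rfl fun l _ => contract_tmul _ _ _ _

end Theta

/-! ### Exact sequences -/

section Exact

variable {k : Type u} [Field k] {A : Type v} [Ring A] [Algebra k A]

/-- Lets exactness in A-mod be tested on elements. -/
instance : (isFd k A).ι.PreservesHomology where
  preservesKernels := (isFd k A).preservesKernels_ι
  preservesCokernels := (isFd k A).preservesCokernels_ι

theorem fd_exact_iff (S : ShortComplex (FdMod k A)) :
    S.Exact ↔ Function.Exact S.f.hom.hom S.g.hom.hom := by
  rw [← ShortComplex.exact_map_iff_of_faithful S (isFd k A).ι]
  exact ShortComplex.ShortExact.moduleCat_exact_iff_function_exact _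

theorem fd_mono_iff {M N : FdMod k A} (f : M ⟶ N) : Mono f ↔ Function.Injective f.hom.hom := by
  rw [← ModuleCat.mono_iff_injective]
  have := (isFd k A).preservesMonomorphisms_ι_of_isNormalEpiCategory
  exact ((isFd k A).ι.mono_map_iff_mono f).symm

theorem fd_epi_iff {M N : FdMod k A} (f : M ⟶ N) : Epi f ↔ Function.Surjective f.hom.hom := by
  rw [← ModuleCat.epi_iff_surjective]
  have := (isFd k A).preservesEpimorphisms_ι_of_isNormalMonoCategory
  exact ((isFd k A).ι.epi_map_iff_epi f).symm

theorem fd_shortExact_iff (S : ShortComplex (FdMod k A)) :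
    S.ShortExact ↔ Function.Injective S.f.hom.hom ∧ Function.Exact S.f.hom.hom S.g.hom.hom ∧
      Function.Surjective S.g.hom.hom := by
  rw [← fd_exact_iff, ← fd_mono_iff, ← fd_epi_iff]
  exact ⟨fun h => ⟨h.mono_f, h.exact, h.epi_g⟩, fun ⟨h1, h2, h3⟩ => ⟨h2⟩⟩

theorem rep_exact {r s : ℕ} {n : Fin r → Fin s → ℕ} {S : ShortComplex (KRep k n)} (h : S.Exact)
    (a : Paths (BipQuiver n)) : Function.Exact (S.f.app a).hom.hom (S.g.app a).hom.hom :=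
  (ShortComplex.ShortExact.moduleCat_exact_iff_function_exact _).1
    ((h.map ((evaluation _ (FGModuleCat.{u} k)).obj a)).map
      (forget₂ (FGModuleCat.{u} k) (ModuleCat.{u} k)))

/-- Tensoring over a field is exact, and exactness of a finite product is checked factor by factor.
-/
theorem sumTensorMap_exact {m : ℕ} (U : Fin m → FdMod k A) {V V' V'' : Fin m → FGModuleCat.{u} k}
    (f : ∀ i, V i →ₗ[k] V' i) (g : ∀ i, V' i →ₗ[k] V'' i)
    (h : ∀ i, Function.Exact (f i) (g i)) :
    Function.Exact (sumTensorMap U f) (sumTensorMap U g) := by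
  have h' := fun i => Module.Flat.lTensor_exact (U i).obj (h i)
  intro z
  constructor
  · intro hz
    choose y hy using fun i => (h' i (z i)).1 (congrFun hz i)
    exact ⟨y, funext hy⟩
  · rintro ⟨y, rfl⟩
    exact funext fun i => (h' i _).2 ⟨y i, rfl⟩

end Exact

/-! ### Exactness and faithfulness of `F`, and lifting of morphisms modulo the radical -/

section Functor

variable {k : Type u} [Field k] {A : Type v} [Ring A] [Algebra k A]

theorem sumTensorMap_add {m : ℕ} (U : Fin m → FdMod k A) {V V' : Fin m → FGModuleCat.{u} k}
    (f g : ∀ i, V i →ₗ[k] V' i) (z : SumTensor U V) :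
    sumTensorMap U (fun i => f i + g i) z = sumTensorMap U f z + sumTensorMap U g z := by
  funext i
  simp [sumTensorMap, TensorProduct.AlgebraTensorModule.map_add_right]

theorem sumTensorMap_smul {m : ℕ} (U : Fin m → FdMod k A) {V V' : Fin m → FGModuleCat.{u} k}
    (c : k) (f : ∀ i, V i →ₗ[k] V' i) (z : SumTensor U V) :
    sumTensorMap U (fun i => c • f i) z = c • sumTensorMap U f z := by
  funext i
  simp [sumTensorMap, TensorProduct.AlgebraTensorModule.map_smul_right]

/-- Linear forms separate the vectors of V_i: contracting with ξ gives (ξ v - ξ w) x = 0 with x ≠ 0.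
-/
theorem inc_injective {m : ℕ} {U : Fin m → FdMod k A} {V : Fin m → FGModuleCat.{u} k} {i : Fin m}
    {x : (U i).obj} (hx : x ≠ 0) {v w : V i} (h : inc U i v x = inc U i w x) : v = w := by
  rw [← sub_eq_zero, ← Module.forall_dual_apply_eq_zero_iff k]
  intro ξ
  have h1 := congrArg (prj U i ξ) h
  rw [prj_inc_same, prj_inc_same, ← sub_eq_zero, ← sub_smul, ← map_sub] at h1
  exact (smul_eq_zero.1 h1).resolve_right hx

theorem exists_ne_zero {M : FdMod k A} (hM : ¬ IsZero M) : ∃ x : M.obj, x ≠ 0 := by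
  by_contra h
  push Not at h
  exact hM ((IsZero.iff_id_eq_zero M).2 (fdHom_ext fun x => by rw [h x, map_zero, map_zero]))

variable {r s : ℕ} (X : Fin r → FdMod k A) (Y : Fin s → FdMod k A) {n : Fin r → Fin s → ℕ}
  (ζ : ∀ i j, Fin (n i j) → Z k A (Y j).obj (X i).obj)

/-- The left diagonal entry of `F φ`. -/
abbrev mapX {M M' : KRep k n} (φ : M ⟶ M') :
    SumTensor X (atX M) →ₗ[A] SumTensor X (atX M') :=
  sumTensorMap X fun i => (φ.app ((Paths.of (BipQuiver n)).obj (.x i))).hom.hom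

/-- The right diagonal entry of `F φ`. -/
abbrev mapY {M M' : KRep k n} (φ : M ⟶ M') :
    SumTensor Y (atY M) →ₗ[A] SumTensor Y (atY M') :=
  sumTensorMap Y fun j => (φ.app ((Paths.of (BipQuiver n)).obj (.y j))).hom.hom

/-- The cocycle of `F M`. -/
abbrev thetaRep (M : KRep k n) : Z k A (SumTensor Y (atY M)) (SumTensor X (atX M)) :=
  theta X Y ζ fun _ _ l => act M l

instance F_additive : (F X Y ζ).Additive where
  map_add := fdHom_ext fun _ =>
    Prod.ext (sumTensorMap_add X _ _ _) (sumTensorMap_add Y _ _ _)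

theorem F_map_smul {M M' : KRep k n} (c : k) (φ : M ⟶ M') :
    (F X Y ζ).map (c • φ) = c • (F X Y ζ).map φ := by
  refine fdHom_ext fun p => ?_
  rw [smul_hom_apply]
  refine Eq.trans ?_ (ext_smul' _ _ _).symm
  exact Prod.ext (sumTensorMap_smul X _ _ _) (sumTensorMap_smul Y _ _ _)

/-- F sends morphisms to block diagonal maps, so kernel and image split into the X part and the Y
part whatever the cocycles are. -/
theorem F_exact (S : ShortComplex (KRep k n)) (hS : S.Exact) : (S.map (F X Y ζ)).Exact := by
  rw [fd_exact_iff]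
  have hx := sumTensorMap_exact X _ _ fun i => rep_exact hS ((Paths.of (BipQuiver n)).obj (.x i))
  have hy := sumTensorMap_exact Y _ _ fun j => rep_exact hS ((Paths.of (BipQuiver n)).obj (.y j))
  intro p
  constructor
  · intro h
    obtain ⟨q1, h1⟩ := (hx _).1 (congrArg Prod.fst h)
    obtain ⟨q2, h2⟩ := (hy _).1 (congrArg Prod.snd h)
    exact ⟨(q1, q2), Prod.ext h1 h2⟩
  · rintro ⟨q, rfl⟩
    exact Prod.ext ((hx _).2 ⟨_, rfl⟩) ((hy _).2 ⟨_, rfl⟩)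

theorem F_preserves : PreservesFiniteLimits (F X Y ζ) ∧ PreservesFiniteColimits (F X Y ζ) :=
  ((F X Y ζ).exact_tfae.out 1 3).1 (F_exact X Y ζ)

theorem mapX_eq {M M' : KRep k n} {φ ψ : M ⟶ M'} (h : (F X Y ζ).map φ = (F X Y ζ).map ψ)
    (z : SumTensor X (atX M)) : mapX X φ z = mapX X ψ z := by
  let p : SumTensor X (atX M) × SumTensor Y (atY M) := (z, 0)
  exact congrArg Prod.fst (congrArg (fun q => q.hom.hom p) h)

theorem mapY_eq {M M' : KRep k n} {φ ψ : M ⟶ M'} (h : (F X Y ζ).map φ = (F X Y ζ).map ψ)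
    (z : SumTensor Y (atY M)) : mapY Y φ z = mapY Y ψ z := by
  let p : SumTensor X (atX M) × SumTensor Y (atY M) := (0, z)
  exact congrArg Prod.snd (congrArg (fun q => q.hom.hom p) h)

theorem F_faithful (hX : ∀ i, ¬ IsZero (X i)) (hY : ∀ j, ¬ IsZero (Y j)) :
    (F X Y ζ).Faithful where
  map_injective {M M'} φ ψ h := by
    refine rep_hom_ext (fun i => LinearMap.ext fun v => ?_) fun j => LinearMap.ext fun w => ?_
    · obtain ⟨x, hx⟩ := exists_ne_zero (hX i)
      have h1 := mapX_eq X Y ζ h (inc (V := atX M) X i v x)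
      rw [sumTensorMap_inc, sumTensorMap_inc] at h1
      exact inc_injective hx h1
    · obtain ⟨y, hy⟩ := exists_ne_zero (hY j)
      have h1 := mapY_eq X Y ζ h (inc (V := atY M) Y j w y)
      rw [sumTensorMap_inc, sumTensorMap_inc] at h1
      exact inc_injective hy h1

/-- `F M` lies in `𝓕(Y, X)`. -/
theorem filt_ext {V : Fin r → FGModuleCat.{u} k} {W : Fin s → FGModuleCat.{u} k}
    (θ : Z k A (SumTensor Y W) (SumTensor X V)) : Filt (⨁ Y) (⨁ X) (ext θ) := by
  let f : fd k A (SumTensor X V) ⟶ ext θ :=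
    let q := ModuleCat.ofHom (extInl θ)
    ObjectProperty.homMk q
  let g : ext θ ⟶ fd k A (SumTensor Y W) :=
    let q := ModuleCat.ofHom (extSnd θ)
    ObjectProperty.homMk q
  refine ⟨ShortComplex.mk f g rfl, (fd_shortExact_iff _).2 ⟨?_, ?_, ?_⟩, addCat_sumTensor X,
    addCat_sumTensor Y, rfl⟩
  · exact fun x y h => congrArg Prod.fst h
  · intro p
    constructor
    · intro h
      exact ⟨(p : SumTensor X V × SumTensor Y W).1, Prod.ext rfl (Eq.symm h)⟩
    · rintro ⟨x, rfl⟩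
      rfl
  · exact fun y => ⟨(0, y), rfl⟩

/-- Linear independence modulo Rad Z + B: both c and 0 represent the same class, and representations
are unique. -/
theorem IsBasisModRad.eq_zero {Y' X' N M : FdMod k A} {m : ℕ} {b : Fin m → Z k A N.obj M.obj}
    (hb : IsBasisModRad Y' X' N M b) (c : Fin m → k)
    (h : ∑ l, c l • b l ∈ radZ Y' X' N M ⊔ B k A N.obj M.obj) : c = 0 :=
  (hb (∑ l, c l • b l)).unique
    (by
      have e : ∑ l, c l • b l - ∑ l, c l • b l = 0 := sub_self (∑ l, c l • b l)
      rw [e]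
      exact Submodule.zero_mem _)
    (by
      have e : ∑ l, c l • b l - ∑ l, (0 : Fin m → k) l • b l = ∑ l, c l • b l :=
        cocycle_ext fun a y => by
          rw [sub_apply, sum_apply, sum_apply]
          rw [Finset.sum_eq_zero (s := Finset.univ)
            (f := fun l => (((0 : Fin m → k) l • b l).1 a y)),
            sub_zero]
          exact fun l _ => zero_smul k ((b l).1 a y)
      rwa [e])

theorem push_mem_radZ {V : Fin r → FGModuleCat.{u} k} (i : Fin r) {N : FdMod k A}
    (f : SumTensor X V →ₗ[A] (X i).obj) (hf : IsRadical (fdHom k f))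
    (z : Z k A N.obj (SumTensor X V)) : push f z ∈ radZ (⨁ Y) (⨁ X) N (X i) := by
  -- An identity map, used only to give z values in the bundled object.
  let e : SumTensor X V →ₗ[A] (fd k A (SumTensor X V)).obj := LinearMap.id
  exact Submodule.subset_span (Or.inl ⟨fd k A (SumTensor X V), fdHom k f, push e z,
    addCat_sumTensor X, hf, rfl⟩)

theorem pull_mem_radZ {W : Fin s → FGModuleCat.{u} k} (j : Fin s) {M : FdMod k A}
    (g : (Y j).obj →ₗ[A] SumTensor Y W) (hg : IsRadical (fdHom k g))
    (z : Z k A (SumTensor Y W) M.obj) : pull z g ∈ radZ (⨁ Y) (⨁ X) (Y j) M := by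
  let e : (fd k A (SumTensor Y W)).obj →ₗ[A] SumTensor Y W := LinearMap.id
  exact Submodule.subset_span (Or.inr ⟨fd k A (SumTensor Y W), fdHom k g, pull z e,
    addCat_sumTensor Y, hg, rfl⟩)

/-- Every morphism `F M ⟶ F M'` is of the form `F φ` up to a triangular morphism with radical
diagonal. -/
theorem exists_sub_F_map [IsAlgClosed k]
    (hX : ∀ i, Indecomposable (X i)) (hY : ∀ j, Indecomposable (Y j))
    (hXX : ∀ i i', i ≠ i' → IsEmpty (X i ≅ X i')) (hYY : ∀ j j', j ≠ j' → IsEmpty (Y j ≅ Y j'))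
    (h0 : ∀ i j (f : X i ⟶ Y j), f = 0)
    (hζ : ∀ i j, IsBasisModRad (⨁ Y) (⨁ X) (Y j) (X i) (ζ i j))
    {M M' : KRep k n} (f : (F X Y ζ).obj M ⟶ (F X Y ζ).obj M') :
    ∃ (φ : M ⟶ M') (p : SumTensor X (atX M) →ₗ[A] SumTensor X (atX M'))
      (q : SumTensor Y (atY M) →ₗ[A] SumTensor Y (atY M'))
      (t : SumTensor Y (atY M) →ₗ[k] SumTensor X (atX M'))
      (h : IsTri (thetaRep X Y ζ M) (thetaRep X Y ζ M') p q t),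
      IsRadical (fdHom k p) ∧ IsRadical (fdHom k q) ∧
        f - (F X Y ζ).map φ = triHom _ _ p q t h := by
  obtain ⟨f1, f2, t, h, rfl⟩ := exists_triHom _ _ (fun e => sumTensor_hom_eq_zero X h0 e) f
  obtain ⟨φ, hφ⟩ := exists_sumTensorMap_isRadical X hX hXX f1
  obtain ⟨ψ, hψ⟩ := exists_sumTensorMap_isRadical Y hY hYY f2
  -- The residues commute with the arrows. It suffices to test on a vector w and a linear form ξ,
  -- for all arrows Y_j → X_i at once.
  have hc : ∀ i j l, φ i ∘ₗ act M l = act M' (i := i) (j := j) l ∘ₗ ψ j := by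
    intro i j l
    refine LinearMap.ext fun w => ?_
    rw [← sub_eq_zero, ← Module.forall_dual_apply_eq_zero_iff k]
    intro ξ
    have key : ∑ l, ξ (φ i (act M l w) - act M' l (ψ j w)) • ζ i j l ∈
        radZ (⨁ Y) (⨁ X) (Y j) (X i) ⊔ B k A (Y j).obj (X i).obj := by
      -- The identity φζ - ζ'ψ = d t - (f1 - φ)ζ + ζ'(f2 - ψ) at the entry given by w and ξ: one
      -- term in B, two in Rad Z.
      have e : ∑ l, ξ (φ i (act M l w) - act M' l (ψ j w)) • ζ i j l =
          push (prj X i ξ) (pull (d k A _ _ t) (inc Y j w)) -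
            push (prj X i ξ ∘ₗ (f1 - sumTensorMap X φ))
              (pull (thetaRep X Y ζ M) (inc Y j w)) +
            pull (push (prj X i ξ) (thetaRep X Y ζ M'))
              ((f2 - sumTensorMap Y ψ) ∘ₗ inc Y j w) := by
        have e1 := push_pull_theta X Y ζ (fun _ _ l => act M l) i j w (ξ ∘ₗ φ i)
        have e2 := push_pull_theta X Y ζ (fun _ _ l => act M' l) i j (ψ j w) ξ
        refine cocycle_ext fun a y => ?_
        have e3 := congrArg (prj X i ξ) (h a (inc Y j w y))
        have e1' := congrArg (fun z => z.1 a y) e1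
        have e2' := congrArg (fun z => z.1 a y) e2
        simp only [sum_apply, smul_apply, LinearMap.comp_apply] at e1' e2'
        simp only [sum_apply, smul_apply, map_sub, sub_smul, Finset.sum_sub_distrib]
        rw [← e1', ← e2']
        simp only [add_apply, sub_apply, push_apply, pull_apply, d_apply, LinearMap.comp_apply,
          LinearMap.sub_apply, map_sub, prj_sumTensorMap, sumTensorMap_inc] at e3 ⊢
        rw [← e3]
        abel
      rw [e]
      refine Submodule.add_mem _ (cocycle_sub_mem _ ?_ ?_) ?_
      · exact Submodule.mem_sup_right (push_mem_B _ (pull_mem_B _ ⟨t, rfl⟩))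
      · exact Submodule.mem_sup_left (push_mem_radZ X Y i _
          (hφ.comp_right (fdHom k (prj X i ξ))) _)
      · exact Submodule.mem_sup_left (pull_mem_radZ X Y j _
          (hψ.comp_left (fdHom k (inc Y j w))) _)
    exact congrFun (IsBasisModRad.eq_zero (hζ i j) _ key) l
  have hn := theta_natural X Y ζ (repHom φ ψ hc)
  refine ⟨repHom φ ψ hc, f1 - sumTensorMap X φ, f2 - sumTensorMap Y ψ, t, ?_, hφ, hψ, ?_⟩
  -- F(φ, ψ) is itself a morphism, so φζ = ζ'ψ and its subtraction leaves t unchanged.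
  · intro a y
    rw [← h]
    have := congrArg (fun z => z.1 a y) hn
    change sumTensorMap X φ _ = (thetaRep X Y ζ M').1 a (sumTensorMap Y ψ y) at this
    simp only [LinearMap.sub_apply, map_sub]
    rw [this]
    abel
  · refine fdHom_ext fun p => Prod.ext ?_ rfl
    change f1 _ + t _ - sumTensorMap X φ _ = f1 _ - sumTensorMap X φ _ + t _
    abel

end Functor

/-! ### Extensions and short exact sequences -/

section Split

variable {k : Type u} [Field k] {A : Type v} [Ring A] [Algebra k A]
variable {N : Type u} [AddCommGroup N] [Module k N] [Module A N] [IsScalarTower k A N]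
variable {M : Type u} [AddCommGroup M] [Module k M] [Module A M] [IsScalarTower k A M]
variable [Module.Finite k M] [Module.Finite k N]

/-- Every short exact sequence is given by a cocycle. -/
theorem exists_ext_iso (E : FdMod k A) (i : M →ₗ[A] E.obj) (p : E.obj →ₗ[A] N)
    (hi : Function.Injective i) (hip : Function.Exact i p) (hp : Function.Surjective p) :
    ∃ z : Z k A N M, Nonempty (ext z ≅ E) := by
  obtain ⟨σ, hσ⟩ := LinearMap.exists_rightInverse_of_surjective (p.restrictScalars k)
    (LinearMap.range_eq_top.2 hp)
  obtain ⟨ρ, hρ⟩ := LinearMap.exists_leftInverse_of_injective (i.restrictScalars k)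
    (LinearMap.ker_eq_bot.2 hi)
  have hσ' : ∀ y, p (σ y) = y := fun y => LinearMap.congr_fun hσ y
  have hρ' : ∀ x, ρ (i x) = x := fun x => LinearMap.congr_fun hρ x
  -- The defect of the k-linear section σ lies in ker p = im i, where i ρ is the identity. So ρ ∘ dσ
  -- is the cocycle of the sequence.
  have hz : ∀ (a : A) y, i (ρ (a • σ y - σ (a • y))) = a • σ y - σ (a • y) := by
    intro a y
    obtain ⟨x, hx⟩ := (hip (a • σ y - σ (a • y))).1 (by
      rw [map_sub, map_smul, hσ', hσ', sub_self])
    rw [← hx, hρ']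
  let z : Z k A N M :=
    ⟨{  toFun := fun a => ρ ∘ₗ (d k A N E.obj σ).1 a
        map_add' := fun a b => by ext y; simp
        map_smul' := fun c a => by ext y; simp },
      fun a b y => by
        apply hi
        change i (ρ ((a * b) • σ y - σ ((a * b) • y))) =
          i (a • ρ (b • σ y - σ (b • y)) + ρ (a • σ (b • y) - σ (a • b • y)))
        rw [map_add, i.map_smul, hz, hz, hz, mul_smul, mul_smul, smul_sub]
        abel⟩
  have hz' : ∀ a y, i (z.1 a y) = a • σ y - σ (a • y) := hz
  let Φ : (ext z).obj →ₗ[A] E.obj :=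
    { toFun := fun q => i (q : M × N).1 + σ (q : M × N).2
      map_add' := fun q q' => by
        change i ((q : M × N).1 + (q' : M × N).1) + σ ((q : M × N).2 + (q' : M × N).2) = _
        rw [map_add, map_add]
        abel
      map_smul' := fun a q => by
        change i (a • (q : M × N).1 + z.1 a (q : M × N).2) + σ (a • (q : M × N).2) =
          a • (i (q : M × N).1 + σ (q : M × N).2)
        rw [map_add, hz', i.map_smul, smul_add]
        abel }
  have hΦ : Function.Bijective (fun q : M × N => i q.1 + σ q.2) := by
    have hpi : ∀ x, p (i x) = 0 := fun x => (hip _).2 ⟨x, rfl⟩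
    constructor
    · intro q q' h
      have h2 := congrArg p h
      simp only [map_add, hpi, zero_add, hσ'] at h2
      simp only [h2, add_left_inj] at h
      exact Prod.ext (hi h) h2
    · intro e
      obtain ⟨x, hx⟩ := (hip (e - σ (p e))).1 (by rw [map_sub, hσ', sub_self])
      exact ⟨(x, p e), by simp [hx]⟩
  let Ψ : ext z ⟶ E :=
    let q := ModuleCat.ofHom Φ
    ObjectProperty.homMk q
  have := isIso_of_bijective Ψ hΦ
  exact ⟨z, ⟨asIso Ψ⟩⟩

/-- `Filt` asks for equality with the middle term, so invariance under isomorphism needs a new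
sequence with that term replaced. -/
theorem filt_of_iso {Y X N N' : FdMod k A} (e : N ≅ N') (h : Filt Y X N) : Filt Y X N' := by
  obtain ⟨S, hS, h1, h3, rfl⟩ := h
  let S' : ShortComplex (FdMod k A) := ShortComplex.mk (S.f ≫ e.hom) (e.inv ≫ S.g) (by simp)
  let e' : S ≅ S' :=
    ShortComplex.isoMk (Iso.refl _) e (Iso.refl _) (by simp [S']) (by simp [S'])
  exact ⟨S', ShortComplex.shortExact_of_iso e' hS, h1, h3, rfl⟩

end Split

/-! ### Families of objects with `dim Hom (U_i, U_i') = δ` -/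

section Ortho

variable {k : Type u} [Field k] {A : Type v} [Ring A] [Algebra k A]
variable {m : ℕ} {U : Fin m → FdMod k A}

theorem exists_sum_of_addCat {T : FdMod k A} (hT : addCat (⨁ U) T) :
    ∃ (N : ℕ) (α : ∀ p : Fin N × Fin m, T ⟶ U p.2) (β : ∀ p : Fin N × Fin m, U p.2 ⟶ T),
      ∑ p, α p ≫ β p = 𝟙 T := by
  obtain ⟨N, a, b, h⟩ := (addCat_iff _ _).1 hT
  refine ⟨N, fun p => a p.1 ≫ biproduct.π U p.2, fun p => biproduct.ι U p.2 ≫ b p.1, ?_⟩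
  rw [← h, Fintype.sum_prod_type]
  refine Finset.sum_congr rfl fun j _ => ?_
  have h' : ∑ i, (a j ≫ biproduct.π U i) ≫ biproduct.ι U i ≫ b j =
      a j ≫ (∑ i, biproduct.π U i ≫ biproduct.ι U i) ≫ b j := by
    simp only [Preadditive.sum_comp, Preadditive.comp_sum, Category.assoc]
  rw [h', biproduct.total, Category.id_comp]

theorem hom_eq_zero_of_ne
    (hδ : ∀ i i', Module.finrank k (U i ⟶ U i') = if i = i' then 1 else 0)
    {i i' : Fin m} (h : i ≠ i') (f : U i ⟶ U i') : f = 0 := by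
  have h0 := hδ i i'
  rw [if_neg h, Module.finrank_zero_iff] at h0
  exact Subsingleton.elim _ _

theorem not_isZero_of_finrank
    (hδ : ∀ i i', Module.finrank k (U i ⟶ U i') = if i = i' then 1 else 0)
    (i : Fin m) : ¬ IsZero (U i) := fun h => by
  have h1 := hδ i i
  have : Subsingleton (U i ⟶ U i) := ⟨fun f g => h.eq_of_src f g⟩
  rw [if_pos rfl, Module.finrank_zero_of_subsingleton] at h1
  exact zero_ne_one h1

theorem exists_eq_smul_id
    (hδ : ∀ i i', Module.finrank k (U i ⟶ U i') = if i = i' then 1 else 0)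
    {i : Fin m} (f : U i ⟶ U i) : ∃ c : k, f = c • 𝟙 (U i) := by
  have h1 := hδ i i
  rw [if_pos rfl] at h1
  obtain ⟨c, hc⟩ := (finrank_eq_one_iff_of_nonzero' (𝟙 (U i)) fun h =>
    not_isZero_of_finrank hδ i ((IsZero.iff_id_eq_zero _).2 h)).1 h1 f
  exact ⟨c, hc.symm⟩

/-- A nonzero radical endomorphism would be a nonzero scalar, and rescaling would make the identity
of a nonzero object radical. -/
theorem eq_zero_of_isRadical
    (hδ : ∀ i i', Module.finrank k (U i ⟶ U i') = if i = i' then 1 else 0)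
    {i i' : Fin m} (f : U i ⟶ U i') (hf : IsRadical f) : f = 0 := by
  by_cases h : i = i'
  · subst h
    obtain ⟨c, rfl⟩ := exists_eq_smul_id hδ f
    by_cases hc : c = 0
    · rw [hc, zero_smul]
    · have h1 := hf.smul c⁻¹
      rw [smul_smul, inv_mul_cancel₀ hc, one_smul] at h1
      exact absurd (isZero_of_isRadical_id h1) (not_isZero_of_finrank hδ i)
  · exact hom_eq_zero_of_ne hδ h f

theorem eq_zero_of_isRadical_left
    (hδ : ∀ i i', Module.finrank k (U i ⟶ U i') = if i = i' then 1 else 0)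
    {T : FdMod k A} (hT : addCat (⨁ U) T) {i : Fin m} (f : T ⟶ U i)
    (hf : IsRadical f) : f = 0 := by
  obtain ⟨N, α, β, h⟩ := exists_sum_of_addCat hT
  rw [← Category.id_comp f, ← h, Preadditive.sum_comp]
  refine Finset.sum_eq_zero fun p _ => ?_
  rw [Category.assoc, eq_zero_of_isRadical hδ _ (hf.comp_left (β p)), comp_zero]

theorem eq_zero_of_isRadical_right
    (hδ : ∀ i i', Module.finrank k (U i ⟶ U i') = if i = i' then 1 else 0)
    {T : FdMod k A} (hT : addCat (⨁ U) T) {i : Fin m} (f : U i ⟶ T)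
    (hf : IsRadical f) : f = 0 := by
  obtain ⟨N, α, β, h⟩ := exists_sum_of_addCat hT
  rw [← Category.comp_id f, ← h, Preadditive.comp_sum]
  refine Finset.sum_eq_zero fun p _ => ?_
  rw [← Category.assoc, eq_zero_of_isRadical hδ _ (hf.comp_right (α p)), zero_comp]

theorem sumTensor_eq_zero_of_isRadical
    (hδ : ∀ i i', Module.finrank k (U i ⟶ U i') = if i = i' then 1 else 0)
    {V V' : Fin m → FGModuleCat.{u} k}
    (f : SumTensor U V →ₗ[A] SumTensor U V') (hf : IsRadical (fdHom k f)) : f = 0 := by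
  refine LinearMap.ext fun z => sumTensor_eq_zero U _ fun q => ?_
  let π : fd k A (SumTensor U V') ⟶ U q.1 := fdHom k (prj U q.1 (covec q))
  have h : fdHom k f ≫ π = 0 :=
    eq_zero_of_isRadical_left hδ (addCat_sumTensor U) _ (hf.comp_right _)
  exact congrArg (fun g => g.hom.hom z) h

/-- The evaluation map `⨁ U_i ⊗ Hom (U_i, T) → T`. -/
def evalMap (T : FdMod k A) : SumTensor U (fun i => FGModuleCat.of k (U i ⟶ T)) →ₗ[A] T.obj :=
  ∑ i, TensorProduct.AlgebraTensorModule.lift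
    ({ toFun := fun x =>
        { toFun := fun h => h.hom.hom x
          map_add' := fun _ _ => rfl
          map_smul' := fun _ _ => rfl }
       map_add' := fun x y => LinearMap.ext fun h => map_add h.hom.hom x y
       map_smul' := fun a x => LinearMap.ext fun h => map_smul h.hom.hom a x } :
      (U i).obj →ₗ[A] (U i ⟶ T) →ₗ[k] T.obj) ∘ₗ LinearMap.proj i

theorem evalMap_inc (T : FdMod k A) (i : Fin m) (h : U i ⟶ T) (x : (U i).obj) :
    evalMap T (inc (V := fun i => FGModuleCat.of k (U i ⟶ T)) U i h x) = h.hom.hom x := by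
  rw [evalMap, LinearMap.sum_apply, Finset.sum_eq_single i]
  · simp [inc_apply]
    rfl
  · intro i' _ h'
    simp [inc_apply, Pi.single_eq_of_ne h']
  · simp

/-- Maps between the U_i can be moved across the tensor sign because they are zero or scalars. This
is what makes evaluation injective. -/
theorem inc_hom_comp
    (hδ : ∀ i i', Module.finrank k (U i ⟶ U i') = if i = i' then 1 else 0)
    (T : FdMod k A) {i i' : Fin m} (g : U i ⟶ U i') (h : U i' ⟶ T)
    (x : (U i).obj) :
    inc (V := fun i => FGModuleCat.of k (U i ⟶ T)) U i' h (g.hom.hom x) =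
      inc (V := fun i => FGModuleCat.of k (U i ⟶ T)) U i (g ≫ h) x := by
  by_cases hi : i = i'
  · subst hi
    obtain ⟨c, rfl⟩ := exists_eq_smul_id hδ g
    rw [Linear.smul_comp, Category.id_comp]
    refine Eq.trans ?_ (inc_smul (V := fun i => FGModuleCat.of k (U i ⟶ T)) U i c h x).symm
    change inc (V := fun i => FGModuleCat.of k (U i ⟶ T)) U i h (algebraMap k A c • x) = _
    rw [map_smul, algebraMap_smul]
  · rw [hom_eq_zero_of_ne hδ hi g, zero_comp]
    change inc (V := fun i => FGModuleCat.of k (U i ⟶ T)) U i' h 0 = _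
    rw [map_zero]
    have := inc_smul (V := fun i => FGModuleCat.of k (U i ⟶ T)) U i (0 : k) (0 : U i ⟶ T) x
    rw [zero_smul, zero_smul] at this
    exact this.symm

/-- An object of `add (⨁ U_i)` is isomorphic to `⨁ U_i ⊗ Hom (U_i, T)`. -/
theorem evalMap_bijective
    (hδ : ∀ i i', Module.finrank k (U i ⟶ U i') = if i = i' then 1 else 0)
    {T : FdMod k A} (hT : addCat (⨁ U) T) :
    Function.Bijective (evalMap (U := U) T) := by
  obtain ⟨N, α, β, h⟩ := exists_sum_of_addCat hT
  let V : Fin m → FGModuleCat.{u} k := fun i => FGModuleCat.of k (U i ⟶ T)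
  -- The inverse of evaluation, built from a factorization of the identity of T through the U_i.
  let σ : T.obj →ₗ[A] SumTensor U V := ∑ p, inc (V := V) U p.2 (β p) ∘ₗ (α p).hom.hom
  have hσ : ∀ x, σ x = ∑ p, inc (V := V) U p.2 (β p) ((α p).hom.hom x) := fun x => by
    simp only [σ, LinearMap.sum_apply, LinearMap.comp_apply]
  have h1 : ∀ x, evalMap (U := U) T (σ x) = x := fun x => by
    rw [hσ, map_sum]
    have h2 := congrArg (fun g => g.hom.hom x) h
    simp only [sum_hom_apply] at h2
    refine Eq.trans (Finset.sum_congr rfl fun p _ => ?_) h2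
    exact evalMap_inc T p.2 (β p) _
  have h2 : σ ∘ₗ evalMap (U := U) T = LinearMap.id := by
    refine sub_eq_zero.1 (hom_eq_zero_of_entry U _ fun ⟨i, t⟩ => LinearMap.ext fun x => ?_)
    generalize vec (V := V) ⟨i, t⟩ = g
    change (U i ⟶ T) at g
    change σ (evalMap T (inc (V := V) U i g x)) - inc (V := V) U i g x = 0
    rw [sub_eq_zero, evalMap_inc, hσ]
    let I : (U i ⟶ T) →+ SumTensor U V :=
      { toFun := fun g => inc (V := V) U i g x
        map_zero' := by
          have := inc_smul (V := V) U i (0 : k) (0 : U i ⟶ T) x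
          rwa [zero_smul, zero_smul] at this
        map_add' := fun g g' => LinearMap.congr_fun (inc_add (V := V) U i g g') x }
    change _ = I g
    have hg : g = ∑ p, g ≫ α p ≫ β p := by
      rw [← Preadditive.comp_sum, h, Category.comp_id]
    rw [congrArg I hg, map_sum]
    refine Finset.sum_congr rfl fun p _ => ?_
    rw [← Category.assoc]
    exact inc_hom_comp hδ T (g ≫ α p) (β p) x
  exact ⟨Function.LeftInverse.injective (g := σ) fun z => LinearMap.congr_fun h2 z,
    fun x => ⟨σ x, h1 x⟩⟩

end Ortho

/-! ### Essential images of full exact functors -/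

section EssImage

variable {C D : Type*} [Category C] [Category D] [Abelian C] [Abelian D] (G : C ⥤ D)
  [G.Additive]

/-- Up to isomorphism a map between objects of P is Gφ by fullness, and its kernel is G(ker φ) by
exactness. -/
theorem isClosedUnderKernels_of_essImage (hG : PreservesFiniteLimits G) (hfull : G.Full)
    {P : ObjectProperty D} (hP : ∀ M, P (G.obj M)) (hiso : ∀ {N N' : D}, (N ≅ N') → P N → P N')
    (hsurj : ∀ N, P N → ∃ M, Nonempty (G.obj M ≅ N)) : P.IsClosedUnderKernels where
  kernels_le := by
    rintro _ ⟨f, K, hK, hf⟩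
    obtain ⟨M, ⟨e⟩⟩ := hsurj _ hf.1
    obtain ⟨M', ⟨e'⟩⟩ := hsurj _ hf.2
    obtain ⟨φ, hφ⟩ := G.map_surjective (e.hom ≫ f ≫ e'.inv)
    exact hiso (PreservesKernel.iso G φ ≪≫ kernel.mapIso _ f e e' (by simp [hφ]) ≪≫
      (hK.conePointUniqueUpToIso (kernelIsKernel f)).symm) (hP (kernel φ))

theorem isClosedUnderCokernels_of_essImage (hG : PreservesFiniteColimits G) (hfull : G.Full)
    {P : ObjectProperty D} (hP : ∀ M, P (G.obj M)) (hiso : ∀ {N N' : D}, (N ≅ N') → P N → P N')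
    (hsurj : ∀ N, P N → ∃ M, Nonempty (G.obj M ≅ N)) : P.IsClosedUnderCokernels where
  cokernels_le := by
    rintro _ ⟨f, K, hK, hf⟩
    obtain ⟨M, ⟨e⟩⟩ := hsurj _ hf.1
    obtain ⟨M', ⟨e'⟩⟩ := hsurj _ hf.2
    obtain ⟨φ, hφ⟩ := G.map_surjective (e.hom ≫ f ≫ e'.inv)
    exact hiso (PreservesCokernel.iso G φ ≪≫ cokernel.mapIso _ f e e' (by simp [hφ]) ≪≫
      (hK.coconePointUniqueUpToIso (cokernelIsCokernel f)).symm) (hP (cokernel φ))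

end EssImage

theorem hom_eq_zero_of_biproduct {C : Type*} [Category C] [Preadditive C] [HasFiniteBiproducts C]
    {p q : ℕ} {U : Fin p → C} {V : Fin q → C} (h : ∀ f : ⨁ U ⟶ ⨁ V, f = 0) {i : Fin p} {j : Fin q}
    (f : U i ⟶ V j) : f = 0 := by
  have e : biproduct.ι U i ≫ (biproduct.π U i ≫ f ≫ biproduct.ι V j) ≫ biproduct.π V j = f := by
    simp
  rw [← e, h (biproduct.π U i ≫ f ≫ biproduct.ι V j), zero_comp, comp_zero]

/-! ### Consequences of lifting modulo the radical, and the case of orthogonal families -/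

section Main

variable {k : Type u} [Field k] {A : Type v} [Ring A] [Algebra k A]
variable {r s : ℕ} (X : Fin r → FdMod k A) (Y : Fin s → FdMod k A) {n : Fin r → Fin s → ℕ}
  (ζ : ∀ i j, Fin (n i j) → Z k A (Y j).obj (X i).obj)

theorem exists_isRadical_sub_F_map [IsAlgClosed k]
    (hX : ∀ i, Indecomposable (X i)) (hY : ∀ j, Indecomposable (Y j))
    (hXX : ∀ i i', i ≠ i' → IsEmpty (X i ≅ X i')) (hYY : ∀ j j', j ≠ j' → IsEmpty (Y j ≅ Y j'))
    (h0 : ∀ i j (f : X i ⟶ Y j), f = 0)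
    (hζ : ∀ i j, IsBasisModRad (⨁ Y) (⨁ X) (Y j) (X i) (ζ i j))
    {M M' : KRep k n} (f : (F X Y ζ).obj M ⟶ (F X Y ζ).obj M') :
    ∃ φ : M ⟶ M', IsRadical (f - (F X Y ζ).map φ) := by
  obtain ⟨φ, p, q, t, h, hp, hq, e⟩ := exists_sub_F_map X Y ζ hX hY hXX hYY h0 hζ f
  refine ⟨φ, ?_⟩
  rw [e]
  exact isRadical_triHom _ _ (fun e => sumTensor_hom_eq_zero X h0 e) p q t h hp hq

/-- A faithful functor reflects monomorphisms and epimorphisms, and the category of representations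
is balanced. -/
theorem isIso_of_isIso_F_map (hX : ∀ i, ¬ IsZero (X i)) (hY : ∀ j, ¬ IsZero (Y j))
    {M M' : KRep k n} (φ : M ⟶ M') (h : IsIso ((F X Y ζ).map φ)) : IsIso φ := by
  have := F_faithful X Y ζ hX hY
  have : Mono φ := (F X Y ζ).mono_of_mono_map inferInstance
  have : Epi φ := (F X Y ζ).epi_of_epi_map inferInstance
  exact isIso_of_mono_of_epi φ

/-- If `F M` and `F M'` are isomorphic then so are `M` and `M'`. -/
noncomputable def isoOfFIso (hX : ∀ i, ¬ IsZero (X i)) (hY : ∀ j, ¬ IsZero (Y j))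
    (hrad : ∀ {M M' : KRep k n} (f : (F X Y ζ).obj M ⟶ (F X Y ζ).obj M'),
      ∃ φ : M ⟶ M', IsRadical (f - (F X Y ζ).map φ))
    {M M' : KRep k n} (e : (F X Y ζ).obj M ≅ (F X Y ζ).obj M') : M ≅ M' :=
  have := isIso_of_isIso_F_map X Y ζ hX hY (hrad e.hom).choose
    (isIso_of_isRadical_sub e.hom _ (hrad e.hom).choose_spec)
  asIso (hrad e.hom).choose

/-- Lift the projection ε onto a summand to φ in End(M) modulo the radical. If φ is invertible then
so is ε; if φ is nilpotent then 1 - ε is invertible. Either way one summand is zero. -/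
theorem indecomposable_F (hX : ∀ i, ¬ IsZero (X i)) (hY : ∀ j, ¬ IsZero (Y j))
    (hrad : ∀ {M M' : KRep k n} (f : (F X Y ζ).obj M ⟶ (F X Y ζ).obj M'),
      ∃ φ : M ⟶ M', IsRadical (f - (F X Y ζ).map φ))
    {M : KRep k n} (hM : Indecomposable M) : Indecomposable ((F X Y ζ).obj M) := by
  have hfaith := F_faithful X Y ζ hX hY
  -- End(M) embeds into the finite-dimensional End(FM) by faithfulness.
  have : Module.Finite k (M ⟶ M) := by
    let G : (M ⟶ M) →ₗ[k] ((F X Y ζ).obj M ⟶ (F X Y ζ).obj M) :=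
      { toFun := fun φ => (F X Y ζ).map φ
        map_add' := fun φ ψ => (F X Y ζ).map_add
        map_smul' := fun c φ => F_map_smul X Y ζ c φ }
    exact Module.Finite.of_injective G (F X Y ζ).map_injective
  have : Module.Finite k (End M) := this
  refine ⟨fun h => hM.1 ((IsZero.iff_id_eq_zero M).2 ?_), fun P Q e => ?_⟩
  · apply (F X Y ζ).map_injective
    rw [CategoryTheory.Functor.map_id, Functor.map_zero]
    exact (IsZero.iff_id_eq_zero _).1 h
  · let ε : (F X Y ζ).obj M ⟶ (F X Y ζ).obj M := e.hom ≫ (biprod.fst ≫ biprod.inl) ≫ e.inv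
    obtain ⟨φ, hφ⟩ := hrad ε
    rcases isIso_or_isNilpotent_of_indecomposable (k := k) hM φ with h | h
    · right
      have h1 : IsIso ε := isIso_of_isRadical_sub ((F X Y ζ).map φ) ε (by simpa using hφ.neg)
      have h2 : IsIso (e.inv ≫ ε ≫ e.hom) := inferInstance
      have h3 : e.inv ≫ ε ≫ e.hom = biprod.fst ≫ biprod.inl := by simp [ε]
      rw [h3] at h2
      have h4 : (biprod.inr : Q ⟶ P ⊞ Q) = 0 := by
        rw [← cancel_mono ((biprod.fst : P ⊞ Q ⟶ P) ≫ (biprod.inl : P ⟶ P ⊞ Q))]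
        simp
      rw [IsZero.iff_id_eq_zero, ← biprod.inr_snd (X := P) (Y := Q), h4, zero_comp]
    · left
      have h0 := isIso_one_sub_of_isNilpotent h
      have h1 : IsIso (𝟙 _ - ε) := isIso_of_isRadical_sub ((F X Y ζ).map (𝟙 M - φ)) _ (by
        rw [Functor.map_sub, CategoryTheory.Functor.map_id, sub_sub_sub_cancel_left]
        exact hφ)
      have h2 : IsIso (e.inv ≫ (𝟙 _ - ε) ≫ e.hom) := inferInstance
      have h3 : e.inv ≫ (𝟙 _ - ε) ≫ e.hom = 𝟙 _ - biprod.fst ≫ biprod.inl := by simp [ε]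
      rw [h3] at h2
      have h4 : (biprod.inl : P ⟶ P ⊞ Q) = 0 := by
        rw [← cancel_mono (𝟙 _ - (biprod.fst : P ⊞ Q ⟶ P) ≫ (biprod.inl : P ⟶ P ⊞ Q))]
        simp
      rw [IsZero.iff_id_eq_zero, ← biprod.inl_fst (X := P) (Y := Q), h4, zero_comp]

variable {X Y} in
theorem radZ_eq_bot
    (hδX : ∀ i i', Module.finrank k (X i ⟶ X i') = if i = i' then 1 else 0)
    (hδY : ∀ j j', Module.finrank k (Y j ⟶ Y j') = if j = j' then 1 else 0) (i : Fin r)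
    (j : Fin s) : radZ (⨁ Y) (⨁ X) (Y j) (X i) = ⊥ := by
  refine Submodule.span_eq_bot.2 ?_
  rintro _ (⟨T, f, z, hT, hf, rfl⟩ | ⟨S, g, z, hS, hg, rfl⟩)
  · rw [eq_zero_of_isRadical_left hδX hT f hf]
    rfl
  · rw [eq_zero_of_isRadical_right hδY hS g hg]
    exact cocycle_ext fun a y => map_zero (z.1 a)

/-- Cocycles whose entries are cohomologous are cohomologous. -/
theorem exists_isTri_of_entry {V : Fin r → FGModuleCat.{u} k} {W : Fin s → FGModuleCat.{u} k}
    (z z' : Z k A (SumTensor Y W) (SumTensor X V))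
    (h : ∀ (p : SumIdx V) (q : SumIdx W), ∃ t : (Y q.1).obj →ₗ[k] (X p.1).obj, ∀ a y,
      prj X p.1 (covec p) (z.1 a (inc Y q.1 (vec q) y)) -
        prj X p.1 (covec p) (z'.1 a (inc Y q.1 (vec q) y)) = a • t y - t (a • y)) :
    ∃ t, IsTri z z' LinearMap.id LinearMap.id t := by
  choose t ht using h
  refine ⟨∑ p, ∑ q, (inc X p.1 (vec p)).restrictScalars k ∘ₗ t p q ∘ₗ
    (prj Y q.1 (covec q)).restrictScalars k, fun a w => ?_⟩
  have hz : ∀ z : Z k A (SumTensor Y W) (SumTensor X V), z.1 a w =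
      ∑ p : SumIdx V, ∑ q : SumIdx W, inc X p.1 (vec p) (prj X p.1 (covec p)
        (z.1 a (inc Y q.1 (vec q) (prj Y q.1 (covec q) w)))) := fun z => by
    simp only [← map_sum]
    rw [sum_inc_prj X, sum_inc_prj Y]
  simp only [LinearMap.id_apply, LinearMap.sum_apply, LinearMap.comp_apply,
    LinearMap.coe_restrictScalars, Finset.smul_sum]
  rw [hz z, hz z', ← Finset.sum_sub_distrib, ← Finset.sum_sub_distrib]
  refine Finset.sum_congr rfl fun p _ => ?_
  rw [← Finset.sum_sub_distrib, ← Finset.sum_sub_distrib]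
  refine Finset.sum_congr rfl fun q _ => ?_
  rw [← map_sub, ht, map_sub, (inc X p.1 (vec p)).map_smul, (prj Y q.1 (covec q)).map_smul]

/-- Up to coboundaries every cocycle is of the form `Θ(c)`. -/
theorem exists_theta_isTri
    (hδX : ∀ i i', Module.finrank k (X i ⟶ X i') = if i = i' then 1 else 0)
    (hδY : ∀ j j', Module.finrank k (Y j ⟶ Y j') = if j = j' then 1 else 0)
    (hζ : ∀ i j, IsBasisModRad (⨁ Y) (⨁ X) (Y j) (X i) (ζ i j))
    {V : Fin r → FGModuleCat.{u} k} {W : Fin s → FGModuleCat.{u} k}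
    (z : Z k A (SumTensor Y W) (SumTensor X V)) :
    ∃ (c : ∀ i j, Fin (n i j) → (W j →ₗ[k] V i)) (t : SumTensor Y W →ₗ[k] SumTensor X V),
      IsTri (theta X Y ζ c) z LinearMap.id LinearMap.id t := by
  have hC : ∀ (p : SumIdx V) (q : SumIdx W), ∃ C : Fin (n p.1 q.1) → k,
      push (prj X p.1 (covec p)) (pull z (inc Y q.1 (vec q))) - ∑ l, C l • ζ p.1 q.1 l ∈
        B k A (Y q.1).obj (X p.1).obj := fun p q => by
    obtain ⟨C, hC, -⟩ := hζ p.1 q.1 (push (prj X p.1 (covec p)) (pull z (inc Y q.1 (vec q))))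
    refine ⟨C, ?_⟩
    rwa [radZ_eq_bot hδX hδY, bot_sup_eq] at hC
  choose C hC using hC
  -- The linear maps whose matrix coefficients in the chosen bases are the coordinates C of the
  -- entries of z.
  let c : ∀ i j, Fin (n i j) → (W j →ₗ[k] V i) := fun i j l =>
    (Module.finBasis k (W j)).constr k fun u =>
      ∑ t, C ⟨i, t⟩ ⟨j, u⟩ l • Module.finBasis k (V i) t
  have hc : ∀ (p : SumIdx V) (q : SumIdx W) l, covec p (c p.1 q.1 l (vec q)) = C p q l := by
    rintro ⟨i, t⟩ ⟨j, u⟩ l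
    simp [c, Finsupp.single_apply]
  refine ⟨c, exists_isTri_of_entry X Y _ z fun p q => ?_⟩
  obtain ⟨t, ht⟩ := hC p q
  -- The sign reverses the difference: t bounds z - Θ(c), while Θ(c) - z is wanted.
  refine ⟨-t, fun a y => ?_⟩
  have h1 := congrArg (fun z => z.1 a y) (push_pull_theta X Y ζ c p.1 q.1 (vec q) (covec p))
  have h2 := congrArg (fun z => z.1 a y) ht
  simp only [hc] at h1
  simp only [sub_apply, d_apply] at h2
  rw [← h1] at h2
  simp only [push_apply, pull_apply] at h2
  rw [LinearMap.neg_apply, LinearMap.neg_apply, smul_neg, sub_neg_eq_add, neg_add_eq_sub,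
    ← neg_sub (a • t y), h2, neg_sub]

/-- Evaluation identifies both ends of the sequence with sums ⨁ U_i ⊗ Hom(U_i, T); the resulting
cocycle is cohomologous to some Θ(c), whose extension is F of the representation with maps c. -/
theorem exists_F_iso
    (hδX : ∀ i i', Module.finrank k (X i ⟶ X i') = if i = i' then 1 else 0)
    (hδY : ∀ j j', Module.finrank k (Y j ⟶ Y j') = if j = j' then 1 else 0)
    (hζ : ∀ i j, IsBasisModRad (⨁ Y) (⨁ X) (Y j) (X i) (ζ i j)) {N : FdMod k A}
    (hN : Filt (⨁ Y) (⨁ X) N) : ∃ M : KRep k n, Nonempty ((F X Y ζ).obj M ≅ N) := by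
  obtain ⟨S, hS, h1, h3, rfl⟩ := hN
  obtain ⟨hi, hip, hp⟩ := (fd_shortExact_iff S).1 hS
  have b1 := evalMap_bijective hδX h1
  have b3 := evalMap_bijective hδY h3
  let e3 := (LinearEquiv.ofBijective _ b3).symm
  obtain ⟨z, ⟨e⟩⟩ := exists_ext_iso S.X₂ (S.f.hom.hom ∘ₗ evalMap (U := X) S.X₁)
    (e3.toLinearMap ∘ₗ S.g.hom.hom) (hi.comp b1.1)
    (fun x => by
      rw [LinearMap.comp_apply, LinearEquiv.coe_coe, LinearEquiv.map_eq_zero_iff]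
      refine (hip x).trans ⟨fun ⟨y, hy⟩ => ?_, fun ⟨y, hy⟩ => ⟨_, hy⟩⟩
      obtain ⟨y', rfl⟩ := b1.2 y
      exact ⟨y', hy⟩)
    (e3.surjective.comp hp)
  obtain ⟨c, t, ht⟩ := exists_theta_isTri X Y ζ hδX hδY hζ z
  have := isIso_triHom _ _ _ _ t ht Function.bijective_id Function.bijective_id
  let e' : (F X Y ζ).obj (repMk _ _ c) ≅ ext z :=
    @asIso _ _ _ _ (triHom (theta X Y ζ c) z LinearMap.id LinearMap.id t ht) this
  exact ⟨repMk _ _ c, ⟨e' ≪≫ e⟩⟩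

theorem F_full [IsAlgClosed k]
    (hX : ∀ i, Indecomposable (X i)) (hY : ∀ j, Indecomposable (Y j))
    (hXX : ∀ i i', i ≠ i' → IsEmpty (X i ≅ X i')) (hYY : ∀ j j', j ≠ j' → IsEmpty (Y j ≅ Y j'))
    (h0 : ∀ i j (f : X i ⟶ Y j), f = 0) (h0' : ∀ j i (f : Y j ⟶ X i), f = 0)
    (hδX : ∀ i i', Module.finrank k (X i ⟶ X i') = if i = i' then 1 else 0)
    (hδY : ∀ j j', Module.finrank k (Y j ⟶ Y j') = if j = j' then 1 else 0)
    (hζ : ∀ i j, IsBasisModRad (⨁ Y) (⨁ X) (Y j) (X i) (ζ i j)) : (F X Y ζ).Full where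
  map_surjective {M M'} f := by
    obtain ⟨φ, p, q, t, h, hp, hq, e⟩ := exists_sub_F_map X Y ζ hX hY hXX hYY h0 hζ f
    obtain rfl := sumTensor_eq_zero_of_isRadical hδX p hp
    obtain rfl := sumTensor_eq_zero_of_isRadical hδY q hq
    -- With zero diagonal the triangular identity says that the corner t is A-linear, so Hom(Y, X) =
    -- 0 kills it.
    let t' : SumTensor Y (atY M) →ₗ[A] SumTensor X (atX M') :=
      { toFun := t
        map_add' := map_add t
        map_smul' := fun a y => by
          have := h a y
          rw [LinearMap.zero_apply, LinearMap.zero_apply, map_zero, sub_zero] at this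
          exact (sub_eq_zero.1 this.symm).symm }
    have ht : ∀ y, t y = 0 := fun y =>
      LinearMap.congr_fun (sumTensor_hom_eq_zero Y h0' t') y
    refine ⟨φ, (sub_eq_zero.1 (e.trans (fdHom_ext fun x => ?_))).symm⟩
    rw [triHom_apply, ht]
    exact Prod.ext (add_zero _) rfl

end Main

end ExtFunctor

/-! ### The main theorem -/

open ExtFunctor in
theorem proposition4p3p2 {k : Type u} [Field k] [IsAlgClosed k] {A : Type v} [Ring A] [Algebra k A]
    {r s : ℕ} (X : Fin r → FdMod k A) (Y : Fin s → FdMod k A)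
    (hX : ∀ i, Indecomposable (X i)) (hY : ∀ j, Indecomposable (Y j))
    (hXX : ∀ i i', i ≠ i' → IsEmpty (X i ≅ X i')) (hYY : ∀ j j', j ≠ j' → IsEmpty (Y j ≅ Y j'))
    (hXY : ∀ f : ⨁ X ⟶ ⨁ Y, f = 0)
    (n : Fin r → Fin s → ℕ) (ζ : ∀ i j, Fin (n i j) → Z k A (Y j).obj (X i).obj)
    (hζ : ∀ i j, IsBasisModRad (⨁ Y) (⨁ X) (Y j) (X i) (ζ i j)) :
    ((F X Y ζ).Additive ∧
      (∀ (M M' : KRep k n) (c : k) (φ : M ⟶ M'), (F X Y ζ).map (c • φ) = c • (F X Y ζ).map φ) ∧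
      (PreservesFiniteLimits (F X Y ζ) ∧ PreservesFiniteColimits (F X Y ζ)) ∧
      (F X Y ζ).Faithful) ∧
    (∀ (M M' : KRep k n) (f : (F X Y ζ).obj M ⟶ (F X Y ζ).obj M'),
      ∃ φ : M ⟶ M', IsRadical (f - (F X Y ζ).map φ)) ∧
    (∀ M : KRep k n, Indecomposable M → Indecomposable ((F X Y ζ).obj M)) ∧
    (∀ M M' : KRep k n, Nonempty ((F X Y ζ).obj M ≅ (F X Y ζ).obj M') → Nonempty (M ≅ M')) ∧
    (∀ M : KRep k n, Filt (⨁ Y) (⨁ X) ((F X Y ζ).obj M)) ∧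
    ((∀ i i', Module.finrank k (X i ⟶ X i') = if i = i' then 1 else 0) →
      (∀ j j', Module.finrank k (Y j ⟶ Y j') = if j = j' then 1 else 0) →
      (∀ N : FdMod k A, Filt (⨁ Y) (⨁ X) N → ∃ M : KRep k n, Nonempty ((F X Y ζ).obj M ≅ N)) ∧
      ((∀ f : ⨁ Y ⟶ ⨁ X, f = 0) →
        (F X Y ζ).Full ∧
        (∃ h : ∀ M : KRep k n, Filt (⨁ Y) (⨁ X) ((F X Y ζ).obj M),
          ((Filt (⨁ Y) (⨁ X)).lift (F X Y ζ) h).IsEquivalence) ∧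
        (Filt (⨁ Y) (⨁ X)).IsClosedUnderKernels ∧
        (Filt (⨁ Y) (⨁ X)).IsClosedUnderCokernels)) := by
  have h0 : ∀ i j (f : X i ⟶ Y j), f = 0 := fun i j => hom_eq_zero_of_biproduct hXY
  have hX0 : ∀ i, ¬ IsZero (X i) := fun i => (hX i).1
  have hY0 : ∀ j, ¬ IsZero (Y j) := fun j => (hY j).1
  have hfaith := F_faithful X Y ζ hX0 hY0
  have hpres := F_preserves X Y ζ
  have hrad := fun {M M'} => exists_isRadical_sub_F_map (M := M) (M' := M') X Y ζ
    hX hY hXX hYY h0 hζ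
  have hfilt : ∀ M : KRep k n, Filt (⨁ Y) (⨁ X) ((F X Y ζ).obj M) := fun M => filt_ext X Y _
  refine ⟨⟨F_additive X Y ζ, fun M M' c φ => F_map_smul X Y ζ c φ, hpres, hfaith⟩,
    fun M M' => hrad, fun M hM => indecomposable_F X Y ζ hX0 hY0 hrad hM,
    fun M M' ⟨e⟩ => ⟨isoOfFIso X Y ζ hX0 hY0 hrad e⟩, hfilt, fun hδX hδY => ?_⟩
  have hsurj : ∀ N : FdMod k A, Filt (⨁ Y) (⨁ X) N →
      ∃ M : KRep k n, Nonempty ((F X Y ζ).obj M ≅ N) :=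
    fun N hN => exists_F_iso X Y ζ hδX hδY hζ hN
  refine ⟨hsurj, fun hYX => ?_⟩
  have h0' : ∀ j i (f : Y j ⟶ X i), f = 0 := fun j i => hom_eq_zero_of_biproduct hYX
  have hfull := F_full X Y ζ hX hY hXX hYY h0 h0' hδX hδY hζ
  -- Fullness and faithfulness pass to the lift by instances; only essential surjectivity is left.
  refine ⟨hfull, ⟨hfilt, { essSurj := ⟨fun N => ?_⟩ }⟩, ?_, ?_⟩
  · obtain ⟨M, ⟨e⟩⟩ := hsurj N.obj N.property
    exact ⟨M, ⟨ObjectProperty.isoMk _ e⟩⟩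
  · exact isClosedUnderKernels_of_essImage (F X Y ζ) hpres.1 hfull hfilt
      (fun e h => filt_of_iso e h) hsurj
  · exact isClosedUnderCokernels_of_essImage (F X Y ζ) hpres.2 hfull hfilt
      (fun e h => filt_of_iso e h) hsurj
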